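/- Let $\mathcal C=\{c_1,\dots,c_N\}$ be a finite set with $N$ elements, let $1\le m\le N$, and let $Z_1,\dots,Z_m$ be random variables sampled uniformly without replacement from $\mathcal C$, i.e. $(Z_1,\dots,Z_m)$ is uniformly distributed over the $m$-tuples of pairwise distinct elements of $\mathcal C$. Let $\mathcal F$ be a nonempty countable class of functions $f\colon\mathcal C\to[-1,1]$ such that $\mathbb E[f(Z_1)]=0$ for all $f\in\mathcal F$. Let $\sigma\ge 0$ with $\sigma^2=\sup_{f\in\mathcal F}\mathbb V[f(Z_1)]$, where $\mathbb V$ denotes the variance, and put $$Q'_m=\sup_{f\in\mathcal F}\sum_{i=1}^m f(Z_i).$$ If $\sigma>0$, then for every $\epsilon\ge 0$ $$\mathbb P\{Q'_m-\mathbb E[Q'_m]\ge\epsilon\}\le\exp\left(-\frac{(N+2)\epsilon^2}{8N^2\sigma^2}\right)\quad\text{and}\quad \mathbb P\{\mathbb E[Q'_m]-Q'_m\ge\epsilon\}\le\exp\left(-\frac{(N+2)\epsilon^2}{8N^2\sigma^2}\right),$$ and for every $\epsilon>0$ $$\exp\left(-\frac{(N+2)\epsilon^2}{8N^2\sigma^2}\right)<\exp\left(-\frac{\epsilon^2}{8N\sigma^2}\right).$$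 If $\sigma=0$, then both probabilities are $0$ for every $\epsilon>0$. Moreover, for every $t\ge 0$, with probability strictly greater than $1-e^{-t}$, $$Q'_m\le\mathbb E[Q'_m]+2\sqrt{2N\sigma^2t}.$$ -/

import Mathlib

open MeasureTheory ProbabilityTheory

/-- The random variables `Z 0, …, Z (m - 1)` are sampled uniformly without replacement from the
finite set `C`: the law of `(Z 0, …, Z (m - 1))` is the uniform distribution on the `m`-tuples of
pairwise distinct elements of `C`. -/
structure IsSampleWithoutReplacement {Ω C : Type*} [MeasurableSpace Ω] [MeasurableSpace C]
    {m : ℕ} (Z : Fin m → Ω → C) (P : Measure Ω) : Prop where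
  measurable : ∀ i, Measurable (Z i)
  law : P.map (fun ω i => Z i ω) = uniformOn {z : Fin m → C | Function.Injective z}

/-- The supremum `sup_{f ∈ F} ∑ i, f (Z i)` of the empirical process. -/
noncomputable def empiricalSup {Ω C : Type*} {m : ℕ} (F : Set (C → ℝ)) (Z : Fin m → Ω → C)
    (ω : Ω) : ℝ :=
  ⨆ f : F, ∑ i, (f : C → ℝ) (Z i ω)

/-- The largest variance `sup_{f ∈ F} Var[f(X)]` over the class `F`. -/
noncomputable def supVariance {Ω C : Type*} [MeasurableSpace Ω] (F : Set (C → ℝ)) (X : Ω → C)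
    (P : Measure Ω) : ℝ :=
  ⨆ f : F, variance (fun ω => (f : C → ℝ) (X ω)) P

/-! Up to a null set the sample enters only through the set of its values, a uniform random
`m`-subset `x` of an `N`-element set. The process becomes `setSup F x`, a supremum of linear
functionals of the indicator vector of `x`. Each coefficient vector `f` is centred and satisfies `∑
f² ≤ V` with `V = Nσ²`.

The engine is the modified logarithmic Sobolev inequality `entropySum_powersetCard_le` on the slice
of `m`-subsets, with constant `2(N + 2)`. It is proved by induction on `N`. Conditioning on whether
`c ∈ x` splits the entropy into the entropies of two smaller slices plus a two-point entropy, and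
the result is averaged over `c`. After symmetrising the exchange `x ↔ y`, the two-point term is
controlled by the sharp inequality `bernoulliEntropy_add_swap_le`.

For the upper tail, if `f` nearly attains the supremum at `x`, exchanging `i` for `j` lowers the
supremum by at most about `f i - f j`. The one-sided squared gradient is then at most `∑ (f i - f
j)² ≤ N V`, and Herbst's argument finishes.

The lower tail has no such gradient bound, because the near-maximiser varies with the point. It goes
through a convex distance inequality instead, `card_div_card_powersetCard_le`. With `W x` the
squared distance from `x` to the convex hull of a set `A` of slice points, `exp (-tW)` satisfies a
self-bounding entropy inequality, so `A = {W = 0}` is small when the mean of `W` is large. For `A =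
{Q ≤ 𝔼Q - ε}`, linearity and Cauchy–Schwarz give `Q ≤ 𝔼Q - ε + √(V W)`. Taking means yields `𝔼W ≥
ε²/V`. -/

open Finset Real

/-- The integrand `(a - b) * (log a - log b)` of the modified logarithmic Sobolev energy. -/
noncomputable def logGap (a b : ℝ) : ℝ := (a - b) * (log a - log b)

/-- The unnormalised entropy of `f` with respect to the counting measure on `s`. -/
noncomputable def entropySum {ι : Type*} (s : Finset ι) (f : ι → ℝ) : ℝ :=
  ∑ x ∈ s, f x * log (f x) - (∑ x ∈ s, f x) * log ((∑ x ∈ s, f x) / #s)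

/-- Exchange the element `i` of `x` for `j`. -/
def swapElem {α : Type*} [DecidableEq α] (x : Finset α) (i j : α) : Finset α :=
  insert j (x.erase i)

/-- Sum over all pairs of neighbours in the slice of `m`-subsets of `S`. -/
def swapSum {α : Type*} [DecidableEq α] (S : Finset α) (m : ℕ)
    (H : Finset α → Finset α → ℝ) : ℝ :=
  ∑ x ∈ S.powersetCard m, ∑ i ∈ x, ∑ j ∈ S \ x, H x (swapElem x i j)

/-! ### Entropy on the two-point space -/

lemma logGap_nonneg {a b : ℝ} (ha : 0 < a) (hb : 0 < b) : 0 ≤ logGap a b := by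
  unfold logGap
  rcases le_total a b with h | h
  · exact mul_nonneg_of_nonpos_of_nonpos (by linarith) (by linarith [log_le_log ha h])
  · exact mul_nonneg (by linarith) (by linarith [log_le_log hb h])

/-- The odd power series of `log (1 + z) - log (1 - z)` has nonnegative coefficients, and `r ^ (2k +
1) ≤ r` termwise. -/
lemma log_sub_log_le_mul {r z : ℝ} (hr0 : 0 ≤ r) (hr1 : r ≤ 1) (hz0 : 0 ≤ z) (hz1 : z < 1) :
    log (1 + r * z) - log (1 - r * z) ≤ r * (log (1 + z) - log (1 - z)) := by
  have hrz : r * z ≤ z := mul_le_of_le_one_left hz0 hr1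
  have h1 := hasSum_log_sub_log_of_abs_lt_one
    (abs_lt.2 ⟨by linarith [mul_nonneg hr0 hz0], hrz.trans_lt hz1⟩)
  have h2 := (hasSum_log_sub_log_of_abs_lt_one
    (abs_lt.2 ⟨by linarith, hz1⟩)).mul_left r
  refine hasSum_le (fun k => ?_) h1 h2
  have h3 : r ^ (2 * k + 1) ≤ r := pow_le_of_le_one hr0 hr1 (by omega)
  have h4 : 0 ≤ 2 * (1 / (2 * (k : ℝ) + 1)) * z ^ (2 * k + 1) := by positivity
  rw [mul_pow]
  linarith [mul_le_mul_of_nonneg_right h3 h4]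

/-- Both sides agree at `r = 1`, and their difference is monotone in `r` on `[0, 1]`. After scaling
by `s / 2`, the sign of its derivative is exactly `log_sub_log_le_mul` at `z = d / s`. With `r = 2p
- 1` the factor `(1 - r²) / 4` is `p (1 - p)`. -/
lemma entropy_gap_le {a b r : ℝ} (hb : 0 < b) (hab : b ≤ a) (hr0 : 0 ≤ r) (hr1 : r ≤ 1) :
    a * log a + b * log b - (a + b + r * (a - b)) / 2 * log ((a + b + r * (a - b)) / 2)
      - (a + b - r * (a - b)) / 2 * log ((a + b - r * (a - b)) / 2)
      ≤ (1 - r ^ 2) / 4 * logGap a b := by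
  set d := a - b with hd
  set s := a + b with hs
  have hd0 : 0 ≤ d := sub_nonneg.2 hab
  have hsd : d < s := by linarith
  have hs0 : 0 < s := by linarith
  set F : ℝ → ℝ := fun r => a * log a + b * log b - (s + r * d) / 2 * log ((s + r * d) / 2)
      - (s - r * d) / 2 * log ((s - r * d) / 2) - (1 - r ^ 2) / 4 * logGap a b with hF
  have hM : ∀ r ∈ Set.Icc (0 : ℝ) 1, 0 < (s + r * d) / 2 ∧ 0 < (s - r * d) / 2 := by
    intro r hr
    have h1 := mul_le_mul_of_nonneg_right hr.2 hd0
    have h2 := mul_nonneg hr.1 hd0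
    constructor <;> linarith
  have hder : ∀ r ∈ Set.Icc (0 : ℝ) 1, HasDerivAt F
      (d / 2 * (r * (log a - log b) - (log ((s + r * d) / 2) - log ((s - r * d) / 2)))) r := by
    intro r hr
    have e1 : HasDerivAt (fun r : ℝ => (s + r * d) / 2) (d / 2) r := by
      simpa using (((hasDerivAt_id r).mul_const d).const_add s).div_const 2
    have e2 : HasDerivAt (fun r : ℝ => (s - r * d) / 2) (-d / 2) r := by
      simpa using (((hasDerivAt_id r).mul_const d).const_sub s).div_const 2
    have e3 := (hasDerivAt_mul_log (hM r hr).1.ne').comp r e1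
    have e4 := (hasDerivAt_mul_log (hM r hr).2.ne').comp r e2
    have e5 : HasDerivAt (fun r : ℝ => (1 - r ^ 2) / 4 * logGap a b)
        (-(r / 2) * logGap a b) r := by
      refine ((((hasDerivAt_id r).pow 2).const_sub 1).div_const 4 |>.mul_const
        (logGap a b)).congr_deriv ?_
      simp only [id]
      ring
    refine (((e3.const_sub (a * log a + b * log b)).sub e4).sub e5).congr_deriv ?_
    unfold logGap
    rw [← hd]
    ring
  have hmono : MonotoneOn F (Set.Icc 0 1) := by
    refine monotoneOn_of_deriv_nonneg (convex_Icc 0 1)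
      (fun r hr => (hder r hr).continuousAt.continuousWithinAt)
      (fun r hr => (hder r (interior_subset hr)).differentiableAt.differentiableWithinAt)
      fun r hr => ?_
    have hr' := interior_subset hr
    rw [(hder r hr').deriv]
    refine mul_nonneg (by linarith) ?_
    have key := log_sub_log_le_mul hr'.1 hr'.2 (div_nonneg hd0 hs0.le) ((div_lt_one hs0).2 hsd)
    have hl : ∀ {u v : ℝ}, 0 < u → v = s / 2 * u → log v = log (s / 2) + log u := by
      intro u v hu hv
      rw [hv, log_mul (by positivity) hu.ne']
    have h1 := mul_le_mul_of_nonneg_right hr'.2 (div_nonneg hd0 hs0.le)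
    have h2 := (div_lt_one hs0).2 hsd
    have h3 : 0 ≤ r * (d / s) := mul_nonneg hr'.1 (div_nonneg hd0 hs0.le)
    have h4 : 0 ≤ d / s := div_nonneg hd0 hs0.le
    have e1 : s / 2 * (1 + d / s) = (s + d) / 2 := by field_simp
    have e2 : s / 2 * (1 - d / s) = (s - d) / 2 := by field_simp
    rw [hl (u := 1 + d / s) (v := a) (by linarith) (by linarith),
      hl (u := 1 - d / s) (v := b) (by linarith) (by linarith),
      hl (u := 1 + r * (d / s)) (v := (s + r * d) / 2) (by linarith) (by field_simp),
      hl (u := 1 - r * (d / s)) (v := (s - r * d) / 2) (by linarith) (by field_simp)]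
    linarith
  have h1 := hmono ⟨hr0, hr1⟩ ⟨zero_le_one, le_rfl⟩ hr1
  have ea : (s + 1 * d) / 2 = a := by rw [hs, hd]; ring
  have eb : (s - 1 * d) / 2 = b := by rw [hs, hd]; ring
  simp only [hF, ea, eb] at h1
  linarith

/-- The entropy of the function with values `a` and `b` under the Bernoulli law with
parameter `p`. -/
noncomputable def bernoulliEntropy (p a b : ℝ) : ℝ :=
  p * (a * log a) + (1 - p) * (b * log b) - (p * a + (1 - p) * b) * log (p * a + (1 - p) * b)

/-- A symmetrised modified logarithmic Sobolev inequality on the two-point space. -/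
lemma bernoulliEntropy_add_swap_le {p a b : ℝ} (hp0 : 0 ≤ p) (hp1 : p ≤ 1) (ha : 0 < a)
    (hb : 0 < b) :
    bernoulliEntropy p a b + bernoulliEntropy p b a ≤ p * (1 - p) * logGap a b := by
  have key : ∀ {p a b : ℝ}, 1 / 2 ≤ p → p ≤ 1 → 0 < b → b ≤ a →
      bernoulliEntropy p a b + bernoulliEntropy p b a ≤ p * (1 - p) * logGap a b := by
    intro p a b hp hp1 hb hab
    have := entropy_gap_le (r := 2 * p - 1) hb hab (by linarith) (by linarith)
    have e1 : (a + b + (2 * p - 1) * (a - b)) / 2 = p * a + (1 - p) * b := by ring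
    have e2 : (a + b - (2 * p - 1) * (a - b)) / 2 = p * b + (1 - p) * a := by ring
    rw [e1, e2] at this
    unfold bernoulliEntropy
    linarith
  have hflip : ∀ p a b : ℝ, bernoulliEntropy (1 - p) a b = bernoulliEntropy p b a := by
    intro p a b
    simp only [bernoulliEntropy, sub_sub_cancel]
    rw [add_comm (p * (b * log b)), add_comm (p * b)]
  have hgap : ∀ a b : ℝ, logGap a b = logGap b a := fun a b => by unfold logGap; ring
  rcases le_total b a with hab | hab <;> rcases le_total (1 / 2) p with hp | hp
  · exact key hp hp1 hb hab
  · have := key (p := 1 - p) (by linarith) (by linarith) hb hab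
    rw [hflip, hflip] at this
    linarith
  · have := key hp hp1 ha hab
    rw [hgap] at this
    linarith
  · have := key (p := 1 - p) (by linarith) (by linarith) ha hab
    rw [hflip, hflip, hgap] at this
    linarith

/-- Tangent-plane form of the joint convexity of `bernoulliEntropy p`. -/
lemma bernoulliEntropy_tangent {p a b x y : ℝ} (hp0 : 0 < p) (hp1 : p < 1) (ha : 0 < a)
    (hb : 0 < b) (hx : 0 < x) (hy : 0 < y) :
    p * (log a - log (p * a + (1 - p) * b)) * x
      + (1 - p) * (log b - log (p * a + (1 - p) * b)) * y ≤ bernoulliEntropy p x y := by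
  have hq : 0 < 1 - p := by linarith
  set M := p * a + (1 - p) * b with hM
  set L := p * x + (1 - p) * y with hL
  have hM0 : 0 < M := by positivity
  have hL0 : 0 < L := by positivity
  have key : ∀ {u v : ℝ}, 0 < u → 0 < v →
      (log L + log u - log M - log v) * v ≤ L * u / M - v := by
    intro u v hu hv
    have h := log_le_sub_one_of_pos (by positivity : 0 < L * u / (M * v))
    rw [log_div (by positivity) (by positivity), log_mul hL0.ne' hu.ne',
      log_mul hM0.ne' hv.ne'] at h
    have h2 := mul_le_mul_of_nonneg_right h hv.le
    have e : (L * u / (M * v) - 1) * v = L * u / M - v := by field_simp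
    rw [e] at h2
    linarith
  have h1 := mul_le_mul_of_nonneg_left (key ha hx) hp0.le
  have h2 := mul_le_mul_of_nonneg_left (key hb hy) hq.le
  have e : p * (L * a / M - x) + (1 - p) * (L * b / M - y) = 0 := by
    have : p * (L * a / M - x) + (1 - p) * (L * b / M - y)
        = L * (p * a + (1 - p) * b) / M - (p * x + (1 - p) * y) := by ring
    rw [this, ← hM, ← hL, mul_div_cancel_right₀ _ hM0.ne', sub_self]
  have e2 : L * log L = p * x * log L + (1 - p) * y * log L := by rw [hL]; ring
  unfold bernoulliEntropy
  rw [← hL, e2]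
  linarith

/-- Jensen's inequality for `bernoulliEntropy p`. -/
lemma card_mul_bernoulliEntropy_le {ι : Type*} (s : Finset ι) (u v : ι → ℝ)
    (hu : ∀ k ∈ s, 0 < u k) (hv : ∀ k ∈ s, 0 < v k) {p a b : ℝ} (hp0 : 0 < p) (hp1 : p < 1)
    (ha : 0 < a) (hb : 0 < b) (hua : ∑ k ∈ s, u k = #s * a) (hvb : ∑ k ∈ s, v k = #s * b) :
    #s * bernoulliEntropy p a b ≤ ∑ k ∈ s, bernoulliEntropy p (u k) (v k) := by
  have := Finset.sum_le_sum fun k hk =>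
    bernoulliEntropy_tangent hp0 hp1 ha hb (hu k hk) (hv k hk)
  rw [sum_add_distrib, ← mul_sum, ← mul_sum, hua, hvb] at this
  refine le_trans (le_of_eq ?_) this
  unfold bernoulliEntropy
  ring

lemma swapElem_comm_insert {α : Type*} [DecidableEq α] {x : Finset α} {c i j : α}
    (hic : i ≠ c) : insert c (swapElem x i j) = swapElem (insert c x) i j := by
  unfold swapElem
  rw [Finset.erase_insert_of_ne hic.symm, Finset.insert_comm]

/-! ### Exchanges on a slice and conditioning on one element -/

section Slice

variable {α : Type*} [DecidableEq α]

lemma swapSum_nonneg {S : Finset α} {m : ℕ} {H : Finset α → Finset α → ℝ}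
    (hH : ∀ x y, 0 ≤ H x y) : 0 ≤ swapSum S m H :=
  sum_nonneg fun _ _ => sum_nonneg fun _ _ => sum_nonneg fun _ _ => hH _ _

lemma swapSum_mono {S : Finset α} {m : ℕ} {H K : Finset α → Finset α → ℝ}
    (h : ∀ x ∈ S.powersetCard m, ∀ i ∈ x, ∀ j ∈ S \ x,
      H x (swapElem x i j) ≤ K x (swapElem x i j)) : swapSum S m H ≤ swapSum S m K :=
  sum_le_sum fun x hx => sum_le_sum fun i hi => sum_le_sum fun j hj => h x hx i hi j hj

lemma swapSum_add {S : Finset α} {m : ℕ} {H K : Finset α → Finset α → ℝ} :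
    swapSum S m (fun x y => H x y + K x y) = swapSum S m H + swapSum S m K := by
  simp only [swapSum, sum_add_distrib]

lemma swapSum_const_mul {S : Finset α} {m : ℕ} {H : Finset α → Finset α → ℝ} (r : ℝ) :
    r * swapSum S m H = swapSum S m (fun x y => r * H x y) := by
  simp only [swapSum, mul_sum]

lemma swapElem_mem_powersetCard {S x : Finset α} {m : ℕ} {i j : α} (hx : x ∈ S.powersetCard m)
    (hi : i ∈ x) (hj : j ∈ S \ x) : swapElem x i j ∈ S.powersetCard m := by
  rw [mem_powersetCard] at hx ⊢
  rw [mem_sdiff] at hj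
  refine ⟨insert_subset hj.1 ((erase_subset _ _).trans hx.1), ?_⟩
  rw [swapElem, card_insert_of_notMem (fun h => hj.2 (mem_of_mem_erase h)), card_erase_of_mem hi,
    hx.2]
  have := card_pos.2 ⟨i, hi⟩
  omega

lemma swapElem_swapElem {x : Finset α} {i j : α} (hi : i ∈ x) (hj : j ∉ x) :
    swapElem (swapElem x i j) j i = x := by
  unfold swapElem
  rw [erase_insert (fun h => hj (mem_of_mem_erase h)), insert_erase hi]

/-- Exchanging elements is a symmetric relation. -/
lemma swapSum_flip (S : Finset α) (m : ℕ) (H : Finset α → Finset α → ℝ) :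
    swapSum S m (fun x y => H y x) = swapSum S m H := by
  unfold swapSum
  simp only [← sum_product', sum_sigma']
  refine sum_bij' (fun p _ => ⟨swapElem p.1 p.2.1 p.2.2, (p.2.2, p.2.1)⟩)
    (fun p _ => ⟨swapElem p.1 p.2.1 p.2.2, (p.2.2, p.2.1)⟩) ?_ ?_ ?_ ?_ ?_
  all_goals
    rintro ⟨x, i, j⟩ h
    simp only [mem_sigma, mem_product] at h ⊢
    have hj := mem_sdiff.1 h.2.2
    have hij : i ≠ j := fun e => hj.2 (e ▸ h.2.1)
  iterate 2
    refine ⟨swapElem_mem_powersetCard h.1 h.2.1 h.2.2, ?_, ?_⟩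
    · simp [swapElem]
    · simp only [mem_sdiff, swapElem, mem_insert, mem_erase, not_or]
      exact ⟨(mem_powersetCard.1 h.1).1 h.2.1, hij, by simp⟩
  · rw [swapElem_swapElem h.2.1 hj.2]
  · rw [swapElem_swapElem h.2.1 hj.2]
  · rw [swapElem_swapElem h.2.1 hj.2]

/-- Lets a symmetric energy be bounded through one-sided terms, each weighted by its own starting
point. -/
lemma swapSum_le_two_mul {S : Finset α} {m : ℕ} {H B : Finset α → Finset α → ℝ}
    (h : ∀ x y, H x y ≤ B x y + B y x) : swapSum S m H ≤ 2 * swapSum S m B := by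
  calc swapSum S m H ≤ swapSum S m (fun x y => B x y + B y x) :=
        swapSum_mono fun _ _ _ _ _ _ => h _ _
    _ = 2 * swapSum S m B := by rw [swapSum_add, swapSum_flip, two_mul]

section Conditioning

variable {S : Finset α} {c : α}

/-- Summation over the sets of a slice that contain `c`. -/
lemma sum_powersetCard_filter_mem (hc : c ∈ S) (k : ℕ) (G : Finset α → ℝ) :
    ∑ x ∈ (S.powersetCard (k + 1)) with c ∈ x, G x
      = ∑ x ∈ (S.erase c).powersetCard k, G (insert c x) := by
  symm
  refine sum_bij' (fun x _ => insert c x) (fun x _ => x.erase c) ?_ ?_ ?_ ?_ ?_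
  · intro x hx
    rw [mem_powersetCard] at hx
    have hcx : c ∉ x := fun h => by simpa using hx.1 h
    simp only [mem_filter, mem_powersetCard, card_insert_of_notMem hcx, hx.2, mem_insert_self,
      and_true]
    exact insert_subset hc (hx.1.trans (erase_subset _ _))
  · intro x hx
    simp only [mem_filter, mem_powersetCard] at hx ⊢
    exact ⟨erase_subset_erase _ hx.1.1, by rw [card_erase_of_mem hx.2, hx.1.2]; simp⟩
  · intro x hx
    rw [mem_powersetCard] at hx
    exact erase_insert fun h => by simpa using hx.1 h
  · intro x hx
    exact insert_erase (mem_filter.1 hx).2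
  · intros; rfl

lemma powersetCard_filter_notMem (m : ℕ) :
    {x ∈ S.powersetCard m | c ∉ x} = (S.erase c).powersetCard m := by
  ext x
  simp only [mem_filter, mem_powersetCard, subset_erase]
  tauto

lemma sum_powersetCard_split (hc : c ∈ S) (k : ℕ) (G : Finset α → ℝ) :
    ∑ x ∈ S.powersetCard (k + 1), G x
      = ∑ x ∈ (S.erase c).powersetCard k, G (insert c x)
        + ∑ x ∈ (S.erase c).powersetCard (k + 1), G x := by
  rw [← sum_powersetCard_filter_mem hc, ← powersetCard_filter_notMem,
    sum_filter_add_sum_filter_not]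

lemma swapSum_erase (m : ℕ) (H : Finset α → Finset α → ℝ) :
    swapSum (S.erase c) m H
      = ∑ x ∈ (S.powersetCard m) with c ∉ x,
          ∑ i ∈ x, ∑ j ∈ (S \ x).erase c, H x (swapElem x i j) := by
  rw [powersetCard_filter_notMem]
  unfold swapSum
  simp only [erase_sdiff_comm]

lemma swapSum_insert (hc : c ∈ S) (k : ℕ) (H : Finset α → Finset α → ℝ) :
    swapSum (S.erase c) k (fun x y => H (insert c x) (insert c y))
      = ∑ x ∈ (S.powersetCard (k + 1)) with c ∈ x,
          ∑ i ∈ x.erase c, ∑ j ∈ S \ x, H x (swapElem x i j) := by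
  rw [sum_powersetCard_filter_mem hc]
  refine sum_congr rfl fun x hx => ?_
  have hcx : c ∉ x := fun h => by simpa using (mem_powersetCard.1 hx).1 h
  rw [erase_insert hcx]
  refine sum_congr rfl fun i hi => ?_
  have hs : S.erase c \ x = S \ insert c x := by
    ext j; simp only [mem_sdiff, mem_erase, mem_insert]; tauto
  rw [hs]
  refine sum_congr rfl fun j _ => ?_
  rw [← swapElem_comm_insert fun e : i = c => hcx (e ▸ hi)]

end Conditioning

lemma sum_sum_erase (s : Finset α) (g : α → ℝ) :
    ∑ c ∈ s, ∑ j ∈ s.erase c, g j = ((#s : ℝ) - 1) * ∑ j ∈ s, g j := by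
  have : ∀ c ∈ s, ∑ j ∈ s.erase c, g j = ∑ j ∈ s, g j - g c := fun c hc => by
    rw [← add_sum_erase s g hc]; ring
  rw [sum_congr rfl this, sum_sub_distrib, sum_const, nsmul_eq_mul]
  ring

/-- Each exchange survives conditioning on all but two of the elements of the ground set. -/
lemma sum_swapSum_conditioned (S : Finset α) (k : ℕ) (H : Finset α → Finset α → ℝ) :
    ∑ c ∈ S, (swapSum (S.erase c) k (fun x y => H (insert c x) (insert c y))
      + swapSum (S.erase c) (k + 1) H) = ((#S : ℝ) - 2) * swapSum S (k + 1) H := by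
  have h1 : ∑ c ∈ S, (swapSum (S.erase c) k (fun x y => H (insert c x) (insert c y))
      + swapSum (S.erase c) (k + 1) H)
      = ∑ x ∈ S.powersetCard (k + 1), (∑ c ∈ x, ∑ i ∈ x.erase c, ∑ j ∈ S \ x,
          H x (swapElem x i j)
        + ∑ c ∈ S \ x, ∑ i ∈ x, ∑ j ∈ (S \ x).erase c, H x (swapElem x i j)) := by
    rw [sum_add_distrib, sum_add_distrib, sum_congr rfl fun c hc => swapSum_insert hc k H]
    simp only [swapSum_erase]
    congr 1
    · refine sum_comm' fun c x => ?_
      simp only [mem_filter, mem_powersetCard]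
      exact ⟨fun h => ⟨h.2.2, h.2.1⟩, fun h => ⟨h.2.1 h.1, h.2, h.1⟩⟩
    · refine sum_comm' fun c x => ?_
      simp only [mem_filter, mem_sdiff]
      tauto
  rw [h1, swapSum, mul_sum]
  refine sum_congr rfl fun x hx => ?_
  obtain ⟨hxS, hxc⟩ := mem_powersetCard.1 hx
  rw [sum_sum_erase]
  rw [sum_comm (s := S \ x) (t := x)]
  simp only [sum_sum_erase]
  rw [← mul_sum, ← add_mul, cast_card_sdiff hxS]
  ring

end Slice

/-! ### Modified logarithmic Sobolev inequality on the slice -/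

section LogSobolev

variable {α : Type*} [DecidableEq α]

/-- Double counting of the pairs of a `k`-subset and an element outside of it. -/
lemma sum_sum_insert (R : Finset α) (k : ℕ) (G : Finset α → ℝ) :
    ∑ x ∈ R.powersetCard k, ∑ j ∈ R \ x, G (insert j x)
      = (k + 1) * ∑ y ∈ R.powersetCard (k + 1), G y := by
  have : ∀ y ∈ R.powersetCard (k + 1), (k + 1 : ℝ) * G y = ∑ j ∈ y, G y := fun y hy => by
    rw [sum_const, (mem_powersetCard.1 hy).2, nsmul_eq_mul]; push_cast; rfl
  rw [mul_sum, sum_congr rfl this, sum_sigma', sum_sigma']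
  refine sum_bij' (fun p _ => ⟨insert p.2 p.1, p.2⟩) (fun p _ => ⟨p.1.erase p.2, p.2⟩)
    ?_ ?_ ?_ ?_ ?_
  · rintro ⟨x, j⟩ h
    simp only [mem_sigma, mem_powersetCard, mem_sdiff] at h ⊢
    exact ⟨⟨insert_subset h.2.1 h.1.1, by rw [card_insert_of_notMem h.2.2, h.1.2]⟩,
      mem_insert_self _ _⟩
  · rintro ⟨y, j⟩ h
    simp only [mem_sigma, mem_powersetCard, mem_sdiff] at h ⊢
    exact ⟨⟨(erase_subset _ _).trans h.1.1, by rw [card_erase_of_mem h.2, h.1.2]; simp⟩,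
      h.1.1 h.2, notMem_erase _ _⟩
  · rintro ⟨x, j⟩ h
    simp only [mem_sigma, mem_sdiff] at h
    simp [erase_insert h.2.2]
  · rintro ⟨y, j⟩ h
    simp only [mem_sigma] at h
    simp [insert_erase h.2]
  · intros; rfl

/-- The entropy between the two halves of a slice determined by an element `c`. -/
lemma entropySum_le_conditioned {S : Finset α} {c : α} (hc : c ∈ S) {k : ℕ} (hk : k + 1 < #S)
    {f : Finset α → ℝ} (hf : ∀ x, 0 < f x) :
    entropySum (S.powersetCard (k + 1)) f
      ≤ entropySum ((S.erase c).powersetCard k) (fun x => f (insert c x))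
        + entropySum ((S.erase c).powersetCard (k + 1)) f
        + #S / ((k + 1) * (#S - (k + 1))) * ∑ x ∈ (S.powersetCard (k + 1)) with c ∈ x,
            ∑ j ∈ S \ x, bernoulliEntropy ((k + 1) / #S) (f x) (f (swapElem x c j)) := by
  rw [sum_powersetCard_filter_mem hc]
  set R := S.erase c with hR
  have hcR : #R + 1 = #S := card_erase_add_one hc
  have hkR : k < #R := by omega
  have hsum : ∀ x ∈ R.powersetCard k, ∑ j ∈ S \ insert c x,
      bernoulliEntropy ((k + 1) / #S) (f (insert c x)) (f (swapElem (insert c x) c j))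
      = ∑ j ∈ R \ x, bernoulliEntropy ((k + 1) / #S) (f (insert c x)) (f (insert j x)) := by
    intro x hx
    have hcx : c ∉ x := fun h => by simpa [hR] using (mem_powersetCard.1 hx).1 h
    have hs : S \ insert c x = R \ x := by
      ext j; simp only [hR, mem_sdiff, mem_erase, mem_insert]; tauto
    simp only [swapElem, erase_insert hcx, hs]
  rw [sum_congr rfl hsum]
  set n₁ : ℝ := (#(R.powersetCard k) : ℝ) with hn₁
  set n₀ : ℝ := (#(R.powersetCard (k + 1)) : ℝ) with hn₀
  have hn₁p : 0 < n₁ := by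
    rw [hn₁, card_powersetCard]; exact_mod_cast Nat.choose_pos hkR.le
  have hn₀p : 0 < n₀ := by
    rw [hn₀, card_powersetCard]; exact_mod_cast Nat.choose_pos hkR
  have hq : (0 : ℝ) < #R - k := by
    have : (k : ℝ) < #R := by exact_mod_cast hkR
    linarith
  have hrel : n₀ * (k + 1) = n₁ * (#R - k) := by
    rw [hn₁, hn₀, card_powersetCard, card_powersetCard, ← Nat.cast_sub hkR.le]
    exact_mod_cast Nat.choose_succ_right_eq _ _
  have hcard : (#(S.powersetCard (k + 1)) : ℝ) = n₁ + n₀ := by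
    rw [hn₁, hn₀, card_powersetCard, card_powersetCard, card_powersetCard, ← hcR,
      Nat.choose_succ_succ]
    push_cast; rfl
  set T₁ := ∑ x ∈ R.powersetCard k, f (insert c x) with hT₁
  set T₀ := ∑ x ∈ R.powersetCard (k + 1), f x with hT₀
  have hne₁ : (R.powersetCard k).Nonempty := powersetCard_nonempty.2 hkR.le
  have hne₀ : (R.powersetCard (k + 1)).Nonempty := powersetCard_nonempty.2 hkR
  have ha : 0 < T₁ / n₁ := div_pos (sum_pos (fun _ _ => hf _) hne₁) hn₁p
  have hb : 0 < T₀ / n₀ := div_pos (sum_pos (fun _ _ => hf _) hne₀) hn₀p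
  have hcs : ∀ x ∈ R.powersetCard k, (#(R \ x) : ℝ) = #R - k := fun x hx => by
    obtain ⟨h1, h2⟩ := mem_powersetCard.1 hx
    rw [cast_card_sdiff h1, h2]
  have hS : (#S : ℝ) = #R + 1 := by rw [← hcR]; push_cast; rfl
  have hS0 : (0 : ℝ) < #S := by rw [hS]; positivity
  set p : ℝ := (k + 1) / #S with hp
  have hp0 : 0 < p := by positivity
  have hp1 : p < 1 := by rw [hp, div_lt_one hS0]; linarith
  have hpn : p = n₁ / (n₁ + n₀) := by
    rw [hp, hS]
    field_simp
    linarith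
  -- A pair `(x, j)` couples the halves: `insert c x` contains `c`, and `insert j x` is its exchange
  -- of `c` for `j`. Both marginals are uniform, so the two means of `f` are averages over these
  -- pairs and Jensen applies.
  have hJ := card_mul_bernoulliEntropy_le ((R.powersetCard k).sigma fun x => R \ x)
    (fun p => f (insert c p.1)) (fun p => f (insert p.2 p.1)) (fun _ _ => hf _) (fun _ _ => hf _)
    hp0 hp1 ha hb
  have hcs' : (#((R.powersetCard k).sigma fun x => R \ x) : ℝ) = n₁ * (#R - k) := by
    rw [card_sigma]; push_cast
    rw [sum_congr rfl hcs, sum_const, nsmul_eq_mul]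
  rw [hcs', sum_sigma, sum_sigma, sum_sigma] at hJ
  specialize hJ (by
    simp only [sum_const, nsmul_eq_mul]
    rw [sum_congr rfl fun x hx => by rw [hcs x hx], ← mul_sum]
    field_simp
    exact hT₁.symm) (by
    dsimp only
    rw [sum_sum_insert R k f, ← hrel]
    field_simp
    exact hT₀.symm)
  have h2 : n₁ * (T₁ / n₁) * log (T₁ / n₁) + n₀ * (T₀ / n₀) * log (T₀ / n₀)
      - (n₁ * (T₁ / n₁) + n₀ * (T₀ / n₀))
        * log ((n₁ * (T₁ / n₁) + n₀ * (T₀ / n₀)) / (n₁ + n₀))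
      = #S / ((k + 1) * (#S - (k + 1)))
        * (n₁ * (#R - k) * bernoulliEntropy p (T₁ / n₁) (T₀ / n₀)) := by
    -- The prefactor turns the number of coupled pairs into the size of the slice.
    have hc1 : (#S : ℝ) / ((k + 1) * (#S - (k + 1))) * (n₁ * (#R - k)) = n₁ + n₀ := by
      have : (#S : ℝ) - (k + 1) = #R - k := by rw [hS]; ring
      rw [this, hS]
      field_simp
      linarith
    have hM : p * (T₁ / n₁) + (1 - p) * (T₀ / n₀)
        = (n₁ * (T₁ / n₁) + n₀ * (T₀ / n₀)) / (n₁ + n₀) := by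
      rw [hpn]
      field_simp
      ring
    rw [← mul_assoc, hc1, bernoulliEntropy, hM, hpn]
    field_simp
    ring
  have h3 := h2.le.trans (mul_le_mul_of_nonneg_left hJ (by
    have : (0 : ℝ) ≤ #S - (k + 1) := by rw [hS]; linarith
    positivity))
  rw [mul_div_cancel₀ _ hn₁p.ne', mul_div_cancel₀ _ hn₀p.ne'] at h3
  have e1 := sum_powersetCard_split hc k f
  have e2 := sum_powersetCard_split hc k fun x => f x * log (f x)
  rw [← hR] at e1 e2
  unfold entropySum
  rw [hcard, e1, e2, ← hn₁, ← hn₀, ← hT₁, ← hT₀]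
  linarith

/-- The modified logarithmic Sobolev inequality on the slice of `m`-subsets of `S`. -/
theorem entropySum_powersetCard_le (S : Finset α) (m : ℕ) {f : Finset α → ℝ}
    (hf : ∀ x, 0 < f x) :
    2 * ((#S : ℝ) + 2) * entropySum (S.powersetCard m) f
      ≤ swapSum S m (fun x y => logGap (f x) (f y)) := by
  have hE : ∀ {g : Finset α → ℝ} (S m), (∀ x, 0 < g x) →
      0 ≤ swapSum S m (fun x y => logGap (g x) (g y)) := fun S m hg =>
    swapSum_nonneg fun _ _ => logGap_nonneg (hg _) (hg _)
  -- On a slice with at most one point the entropy vanishes; this covers `m = 0` and `m ≥ #S`.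
  have htriv : ∀ {S : Finset α} {m : ℕ} {f : Finset α → ℝ}, (∀ x, 0 < f x) →
      (∃ x₀, S.powersetCard m ⊆ {x₀}) → 2 * ((#S : ℝ) + 2) * entropySum (S.powersetCard m) f
      ≤ swapSum S m (fun x y => logGap (f x) (f y)) := by
    rintro S m f hf ⟨x₀, h⟩
    have : entropySum (S.powersetCard m) f = 0 := by
      rcases subset_singleton_iff.1 h with h | h <;> rw [h] <;> simp [entropySum]
    rw [this, mul_zero]
    exact hE S m hf
  induction hn : #S generalizing S m f with
  | zero =>
    obtain rfl := card_eq_zero.1 hn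
    have h := htriv (S := ∅) (m := m) hf ⟨∅, fun x hx => by
      simpa using (mem_powersetCard.1 hx).1⟩
    rwa [card_empty] at h
  | succ n ih =>
    rw [← hn]
    rcases Nat.eq_zero_or_pos m with rfl | hm
    · exact htriv hf ⟨∅, by simp⟩
    rcases le_or_gt #S m with hSm | hSm
    · refine htriv hf ⟨S, fun x hx => ?_⟩
      obtain ⟨h1, h2⟩ := mem_powersetCard.1 hx
      exact mem_singleton.2 (eq_of_subset_of_card_le h1 (by omega))
    obtain ⟨k, rfl⟩ : ∃ k, m = k + 1 := ⟨m - 1, by omega⟩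
    set E := swapSum S (k + 1) (fun x y => logGap (f x) (f y)) with hEdef
    have hnS : (#S : ℝ) = n + 1 := by rw [hn]; push_cast; rfl
    have hkn : (k : ℝ) + 1 < n + 1 := by rw [← hnS]; exact_mod_cast hSm
    have hn1 : (1 : ℝ) ≤ n := by exact_mod_cast (by omega : 1 ≤ n)
    set p : ℝ := (k + 1) / #S with hp
    have hp0 : 0 ≤ p := by rw [hp]; positivity
    set B := ∑ c ∈ S, ∑ x ∈ (S.powersetCard (k + 1)) with c ∈ x,
        ∑ j ∈ S \ x, bernoulliEntropy p (f x) (f (swapElem x c j)) with hB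
    have hBE : #S / ((k + 1) * (#S - (k + 1))) * B ≤ 1 / (2 * #S) * E := by
      have h1 : B = swapSum S (k + 1) (fun x y => bernoulliEntropy p (f x) (f y)) := by
        rw [swapSum]
        refine sum_comm' fun c x => ?_
        simp only [mem_filter, mem_powersetCard]
        exact ⟨fun h => ⟨h.2.2, h.2.1⟩, fun h => ⟨h.2.1 h.1, h.2, h.1⟩⟩
      -- Counting `B` once along `(x, y)` and once along `(y, x)` produces the symmetrised two-point
      -- entropy. The factor `p (1 - p)` then cancels the prefactor, whatever `m` is.
      have h2 : B + B ≤ p * (1 - p) * E := by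
        have h3 : swapSum S (k + 1) (fun x y => bernoulliEntropy p (f y) (f x)) = B := by
          rw [h1]
          exact swapSum_flip S (k + 1) fun x y => bernoulliEntropy p (f x) (f y)
        nth_rw 1 [h1]
        rw [← h3, ← swapSum_add, hEdef, swapSum_const_mul]
        refine swapSum_mono fun x _ i _ j _ => ?_
        refine bernoulliEntropy_add_swap_le hp0 ?_ (hf _) (hf _)
        rw [hp, hnS, div_le_one (by linarith)]
        exact hkn.le
      have h3 : (0 : ℝ) < #S - (k + 1) := by rw [hnS]; linarith
      have h4 : (0 : ℝ) < #S := by rw [hnS]; linarith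
      calc #S / ((k + 1) * (#S - (k + 1))) * B
          ≤ #S / ((k + 1) * (#S - (k + 1))) * (p * (1 - p) * E / 2) :=
            mul_le_mul_of_nonneg_left (by linarith) (by positivity)
        _ = 1 / (2 * #S) * E := by rw [hp]; field_simp
    have hc1 : ∀ c ∈ S, 2 * ((n : ℝ) + 2) * entropySum (S.powersetCard (k + 1)) f
        ≤ (swapSum (S.erase c) k (fun x y => logGap (f (insert c x)) (f (insert c y)))
          + swapSum (S.erase c) (k + 1) (fun x y => logGap (f x) (f y)))
          + 2 * ((n : ℝ) + 2) * (#S / ((k + 1) * (#S - (k + 1)))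
            * ∑ x ∈ (S.powersetCard (k + 1)) with c ∈ x,
            ∑ j ∈ S \ x, bernoulliEntropy p (f x) (f (swapElem x c j))) := by
      intro c hc
      have hce : #(S.erase c) = n := by rw [card_erase_of_mem hc]; omega
      have i1 := ih (S.erase c) k (f := fun x => f (insert c x)) (fun _ => hf _) hce
      have i2 := ih (S.erase c) (k + 1) hf hce
      have := mul_le_mul_of_nonneg_left (entropySum_le_conditioned hc hSm hf)
        (by positivity : (0 : ℝ) ≤ 2 * (n + 2))
      linarith
    have hs := sum_le_sum hc1
    rw [sum_const, nsmul_eq_mul, sum_add_distrib,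
      sum_swapSum_conditioned S k (fun x y => logGap (f x) (f y)), ← mul_sum, ← mul_sum,
      ← hEdef, ← hB] at hs
    have hE0 : 0 ≤ E := hE _ _ hf
    have hs2 := hs.trans (add_le_add_right (mul_le_mul_of_nonneg_left hBE
      (by positivity : (0 : ℝ) ≤ 2 * (n + 2))) _)
    rw [hnS] at hs2 ⊢
    set t := entropySum (S.powersetCard (k + 1)) f
    have h1 : 2 * ((n + 1 : ℝ) ^ 2 * (n + 2) * t) ≤ ((n + 1) * (n - 1) + (n + 2)) * E := by
      have h := mul_le_mul_of_nonneg_left hs2 (by positivity : (0 : ℝ) ≤ n + 1)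
      have e : (n + 1 : ℝ) * ((n + 1 - 2) * E + 2 * (n + 2) * (1 / (2 * (n + 1)) * E))
          = ((n + 1) * (n - 1) + (n + 2)) * E := by
        field_simp
        ring
      rw [e] at h
      linarith
    have h2 : (n + 1 : ℝ) ^ 2 * (n + 2) * (2 * (n + 1 + 2) * t) ≤ (n + 1) ^ 2 * (n + 2) * E := by
      have h3 := mul_le_mul_of_nonneg_left h1 (by positivity : (0 : ℝ) ≤ n + 3)
      -- The right side minus the left side is `n - 1`.
      have h4 : ((n : ℝ) + 3) * ((n + 1) * (n - 1) + (n + 2)) ≤ (n + 1) ^ 2 * (n + 2) := by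
        nlinarith
      have h5 := mul_le_mul_of_nonneg_right h4 hE0
      linarith
    exact le_of_mul_le_mul_left h2 (by positivity)

end LogSobolev

/-! ### Herbst's argument: from entropy to tails -/

section Herbst

open Filter Topology

/-- Stated with a one-sided limit because it is applied to quotients `Λ t / t`, which are
meaningless at `0`. -/
lemma le_of_tendsto_of_deriv_nonpos {F F' : ℝ → ℝ} {b w : ℝ} (hb : 0 < b)
    (hF : ∀ x ∈ Set.Ioc 0 b, HasDerivAt F (F' x) x) (hF' : ∀ x ∈ Set.Ioo 0 b, F' x ≤ 0)
    (hw : Tendsto F (𝓝[>] 0) (𝓝 w)) : F b ≤ w := by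
  have hanti : AntitoneOn F (Set.Ioc 0 b) := by
    refine antitoneOn_of_deriv_nonpos (convex_Ioc 0 b)
      (fun x hx => (hF x hx).continuousAt.continuousWithinAt) (fun x hx => ?_) fun x hx => ?_
    all_goals rw [interior_Ioc] at hx
    · exact (hF x ⟨hx.1, hx.2.le⟩).differentiableAt.differentiableWithinAt
    · rw [(hF x ⟨hx.1, hx.2.le⟩).deriv]
      exact hF' x hx
  refine ge_of_tendsto hw ?_
  filter_upwards [Ioo_mem_nhdsGT hb] with x hx
  exact hanti ⟨hx.1, hx.2.le⟩ ⟨hb, le_rfl⟩ hx.2.le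

lemma tendsto_div_self_of_hasDerivAt {Λ : ℝ → ℝ} {w : ℝ} (h : HasDerivAt Λ w 0) (h0 : Λ 0 = 0) :
    Tendsto (fun t => Λ t / t) (𝓝[>] 0) (𝓝 w) := by
  have := (hasDerivAt_iff_tendsto_slope.1 h).mono_left
    (nhdsWithin_mono 0 fun x (hx : 0 < x) => hx.ne')
  refine this.congr fun t => ?_
  rw [slope_def_field, h0, sub_zero, sub_zero]

lemma hasDerivAt_div_self {Λ : ℝ → ℝ} {d t : ℝ} (h : HasDerivAt Λ d t) (ht : 0 < t) :
    HasDerivAt (fun t => Λ t / t) ((t * d - Λ t) / t ^ 2) t := by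
  refine (h.div (hasDerivAt_id t) ht.ne').congr_deriv ?_
  simp only [id]
  ring

/-- Herbst's argument for a quadratic differential inequality. -/
lemma le_linear_add_sq_of_deriv {Λ Λ' : ℝ → ℝ} (hΛ : ∀ t, HasDerivAt Λ (Λ' t) t) (h0 : Λ 0 = 0)
    {K : ℝ} (h : ∀ t, 0 < t → t * Λ' t - Λ t ≤ K * t ^ 2) {t : ℝ} (ht : 0 ≤ t) :
    Λ t ≤ t * Λ' 0 + K * t ^ 2 := by
  rcases ht.eq_or_lt with rfl | ht
  · simp [h0]
  have := le_of_tendsto_of_deriv_nonpos (F := fun t => Λ t / t - K * t)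
    (F' := fun t => (t * Λ' t - Λ t) / t ^ 2 - K) (w := Λ' 0) ht
    (fun x hx => ((hasDerivAt_div_self (hΛ x) hx.1).sub
      ((hasDerivAt_id x).const_mul K)).congr_deriv (by rw [mul_one]))
    (fun x hx => by
      rw [sub_nonpos, div_le_iff₀ (pow_pos hx.1 2)]
      exact h x hx.1) (by
      have h1 : Tendsto (fun t : ℝ => K * t) (𝓝[>] 0) (𝓝 0) := by
        have : Tendsto (fun t : ℝ => K * t) (𝓝 0) (𝓝 (K * 0)) :=
          (continuous_const.mul continuous_id).tendsto 0
        rw [mul_zero] at this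
        exact this.mono_left nhdsWithin_le_nhds
      simpa using (tendsto_div_self_of_hasDerivAt (hΛ 0) h0).sub h1)
  rw [sub_le_iff_le_add, div_le_iff₀ ht] at this
  linarith

/-- Herbst's argument for the lower tail of a self-bounding function. -/
lemma div_le_of_deriv_selfBounding {ψ ψ' : ℝ → ℝ} (hψ : ∀ t, HasDerivAt ψ (ψ' t) t)
    (h0 : ψ 0 = 0) {κ T : ℝ} (hκ : 0 ≤ κ) (hT : 0 < T)
    (h : ∀ t ∈ Set.Ioo 0 T, ψ t ≤ t * ψ' t * (1 + κ * t)) :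
    T * ψ' 0 / (1 + κ * T) ≤ ψ T := by
  have hkey := le_of_tendsto_of_deriv_nonpos (F := fun t => -(ψ t / t * (1 + κ * t)))
    (F' := fun t => -((t * ψ' t - ψ t) / t ^ 2 * (1 + κ * t) + ψ t / t * κ)) (w := -ψ' 0) hT
    (fun x hx => by
      refine ((hasDerivAt_div_self (hψ x) hx.1).mul ?_).neg
      simpa using ((hasDerivAt_id x).const_mul κ).const_add 1)
    (fun x hx => by
      have hx0 := hx.1
      have h1 := h x hx
      have e : (x * ψ' x - ψ x) / x ^ 2 * (1 + κ * x) + ψ x / x * κ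
          = (x * ψ' x * (1 + κ * x) - ψ x) / x ^ 2 := by
        field_simp
        ring
      rw [e, neg_nonpos]
      -- The factor `1 + κ t` is an integrating factor: the hypothesis says precisely that `ψ t / t
      -- * (1 + κ t)` is nondecreasing.
      exact div_nonneg (sub_nonneg.2 h1) (sq_nonneg x))
    (by
      have h1 : Tendsto (fun t : ℝ => 1 + κ * t) (𝓝[>] 0) (𝓝 1) := by
        have : Tendsto (fun t : ℝ => 1 + κ * t) (𝓝 0) (𝓝 (1 + κ * 0)) :=
          (by fun_prop : Continuous fun t : ℝ => 1 + κ * t).tendsto 0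
        rw [mul_zero, add_zero] at this
        exact this.mono_left nhdsWithin_le_nhds
      simpa using ((tendsto_div_self_of_hasDerivAt (hψ 0) h0).mul h1).neg)
  rw [neg_le_neg_iff, div_mul_eq_mul_div, le_div_iff₀ hT] at hkey
  rw [div_le_iff₀ (by positivity)]
  linarith

variable {ι : Type*}

/-- The logarithm of the moment generating function of `g` under the uniform law on `s`. -/
noncomputable def logMean (s : Finset ι) (g : ι → ℝ) (t : ℝ) : ℝ :=
  log ((∑ x ∈ s, exp (t * g x)) / #s)

lemma hasDerivAt_logMean {s : Finset ι} (hs : s.Nonempty) (g : ι → ℝ) (t : ℝ) :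
    HasDerivAt (logMean s g)
      ((∑ x ∈ s, g x * exp (t * g x)) / ∑ x ∈ s, exp (t * g x)) t := by
  have hc : (0 : ℝ) < #s := by exact_mod_cast hs.card_pos
  have hM : 0 < ∑ x ∈ s, exp (t * g x) := sum_pos (fun _ _ => exp_pos _) hs
  have h1 : HasDerivAt (fun t => ∑ x ∈ s, exp (t * g x)) (∑ x ∈ s, g x * exp (t * g x)) t := by
    refine HasDerivAt.fun_sum fun x _ => ?_
    refine (((hasDerivAt_id t).mul_const (g x)).exp).congr_deriv ?_
    simp only [id]
    ring
  refine ((h1.div_const (#s : ℝ)).log (by positivity)).congr_deriv ?_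
  rw [div_div_div_cancel_right₀ hc.ne']

lemma logMean_zero {s : Finset ι} (hs : s.Nonempty) (g : ι → ℝ) : logMean s g 0 = 0 := by
  have hc : (#s : ℝ) ≠ 0 := by exact_mod_cast hs.card_pos.ne'
  simp [logMean, hc]

lemma sum_exp_eq {s : Finset ι} (hs : s.Nonempty) (g : ι → ℝ) (t : ℝ) :
    (∑ x ∈ s, exp (t * g x)) / #s = exp (logMean s g t) := by
  have hc : (0 : ℝ) < #s := by exact_mod_cast hs.card_pos
  have hM : 0 < ∑ x ∈ s, exp (t * g x) := sum_pos (fun _ _ => exp_pos _) hs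
  rw [logMean, exp_log (by positivity)]

/-- Identifies the entropy with `t Λ' - Λ`, the numerator of the derivative of `Λ t / t`; this is
what turns entropy bounds into differential inequalities. -/
lemma entropySum_exp {s : Finset ι} (hs : s.Nonempty) (g : ι → ℝ) (t : ℝ) :
    entropySum s (fun x => exp (t * g x)) = (∑ x ∈ s, exp (t * g x)) *
      (t * ((∑ x ∈ s, g x * exp (t * g x)) / ∑ x ∈ s, exp (t * g x)) - logMean s g t) := by
  have hM : 0 < ∑ x ∈ s, exp (t * g x) := sum_pos (fun _ _ => exp_pos _) hs
  rw [entropySum, ← logMean, mul_sub]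
  congr 1
  rw [mul_left_comm, mul_div_cancel₀ _ hM.ne', mul_sum]
  refine sum_congr rfl fun x _ => ?_
  rw [log_exp]
  ring

/-- A quadratic entropy bound implies a sub-Gaussian upper tail. -/
theorem card_filter_le_of_entropySum_le {s : Finset ι} (hs : s.Nonempty) (g : ι → ℝ) {K : ℝ}
    (hK : 0 < K) (h : ∀ t, 0 < t → entropySum s (fun x => exp (t * g x))
      ≤ K * t ^ 2 * ∑ x ∈ s, exp (t * g x)) {ε : ℝ} (hε : 0 ≤ ε) :
    (#{x ∈ s | ε ≤ g x - (∑ y ∈ s, g y) / #s} : ℝ) / #s ≤ exp (-(ε ^ 2 / (4 * K))) := by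
  have hc : (0 : ℝ) < #s := by exact_mod_cast hs.card_pos
  set a := (∑ y ∈ s, g y) / #s with ha
  -- Minimiser of the Chernoff exponent `K t² - t ε`.
  set t := ε / (2 * K) with ht
  have ht0 : 0 ≤ t := by positivity
  have hΛ := le_linear_add_sq_of_deriv (hasDerivAt_logMean hs g) (logMean_zero hs g) (K := K)
    (fun t ht => by
      have hM : 0 < ∑ x ∈ s, exp (t * g x) := sum_pos (fun _ _ => exp_pos _) hs
      have := h t ht
      rw [entropySum_exp hs, mul_comm] at this
      exact le_of_mul_le_mul_right this hM) ht0
  simp only [zero_mul, exp_zero, mul_one, sum_const, nsmul_eq_mul, ← ha] at hΛ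
  have h1 : (#{x ∈ s | ε ≤ g x - a} : ℝ) * exp (t * (a + ε)) ≤ ∑ x ∈ s, exp (t * g x) := by
    rw [← nsmul_eq_mul]
    refine (card_nsmul_le_sum _ _ _ fun x hx => ?_).trans
      (sum_le_sum_of_subset_of_nonneg (filter_subset _ s) fun _ _ _ => (exp_pos _).le)
    have := (mem_filter.1 hx).2
    exact exp_le_exp.2 (mul_le_mul_of_nonneg_left (by linarith) ht0)
  have h2 : (#{x ∈ s | ε ≤ g x - a} : ℝ) / #s * exp (t * (a + ε)) ≤ exp (t * a + K * t ^ 2) := by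
    calc _ = (#{x ∈ s | ε ≤ g x - a} : ℝ) * exp (t * (a + ε)) / #s := by ring
      _ ≤ (∑ x ∈ s, exp (t * g x)) / #s := by gcongr
      _ = exp (logMean s g t) := sum_exp_eq hs g t
      _ ≤ _ := exp_le_exp.2 hΛ
  rw [← le_div_iff₀ (exp_pos _), ← exp_sub] at h2
  refine h2.trans (le_of_eq (congrArg exp ?_))
  rw [ht]
  field_simp
  ring

/-- A self-bounding entropy inequality controls the probability that `W` vanishes. -/
theorem card_zero_le_of_entropySum_le {s : Finset ι} (hs : s.Nonempty) (W : ι → ℝ)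
    {κ T : ℝ} (hκ : 0 ≤ κ) (hT : 0 < T)
    (h : ∀ t ∈ Set.Ioo 0 T, entropySum s (fun x => exp (t * -W x))
      ≤ κ * t ^ 2 * ∑ x ∈ s, W x * exp (t * -W x)) :
    (#{x ∈ s | W x = 0} : ℝ) / #s ≤ exp (-(T * ((∑ x ∈ s, W x) / #s) / (1 + κ * T))) := by
  have hc : (0 : ℝ) < #s := by exact_mod_cast hs.card_pos
  have hM : ∀ t, 0 < ∑ x ∈ s, exp (t * -W x) := fun t => sum_pos (fun _ _ => exp_pos _) hs
  have hb := div_le_of_deriv_selfBounding (ψ := fun t => -logMean s (fun x => -W x) t)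
    (ψ' := fun t => (∑ x ∈ s, W x * exp (t * -W x)) / ∑ x ∈ s, exp (t * -W x))
    (fun t => by
      refine (hasDerivAt_logMean hs (fun x => -W x) t).neg.congr_deriv ?_
      simp only [neg_mul, sum_neg_distrib, neg_div, neg_neg])
    (by simp [logMean_zero hs])
    hκ hT (fun t ht => by
      have h1 := h t ht
      rw [entropySum_exp hs (fun x => -W x)] at h1
      set M := ∑ x ∈ s, exp (t * -W x) with hMdef
      set D := ∑ x ∈ s, W x * exp (t * -W x) with hD
      have e : ∑ x ∈ s, -W x * exp (t * -W x) = -D := by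
        simp only [neg_mul, sum_neg_distrib, hD]
      have hMt : 0 < M := hM t
      rw [e, mul_comm, ← le_div_iff₀ hMt] at h1
      have e2 : κ * t ^ 2 * D / M = κ * t ^ 2 * (D / M) := by
        ring
      rw [e2, neg_div] at h1
      linarith)
  simp only [zero_mul, exp_zero, mul_one, sum_const, nsmul_eq_mul] at hb
  calc (#{x ∈ s | W x = 0} : ℝ) / #s
      ≤ (∑ x ∈ s, exp (T * -W x)) / #s := by
        gcongr
        rw [← mul_one (#{x ∈ s | W x = 0} : ℝ), ← nsmul_eq_mul]
        refine (card_nsmul_le_sum _ _ _ fun x hx => ?_).trans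
          (sum_le_sum_of_subset_of_nonneg (filter_subset _ s) fun _ _ _ => (exp_pos _).le)
        simp [(mem_filter.1 hx).2]
    _ = exp (logMean s (fun x => -W x) T) := sum_exp_eq hs _ _
    _ ≤ _ := exp_le_exp.2 (by linarith)

end Herbst

/-! ### Exponential estimates and upper tails on the slice -/

section SliceTails

variable {α : Type*} [DecidableEq α]

lemma logGap_exp_le_sq (a b : ℝ) :
    logGap (exp a) (exp b) ≤ max (a - b) 0 ^ 2 * exp a + max (b - a) 0 ^ 2 * exp b := by
  have key : ∀ a b : ℝ, b ≤ a → (exp a - exp b) * (a - b) ≤ (a - b) ^ 2 * exp a := by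
    intro a b hab
    have h1 : 1 - exp (b - a) ≤ a - b := by linarith [add_one_le_exp (b - a)]
    have h2 := mul_le_mul_of_nonneg_right h1 (exp_pos a).le
    rw [sub_mul, ← exp_add, one_mul, sub_add_cancel] at h2
    nlinarith [mul_le_mul_of_nonneg_right h2 (sub_nonneg.2 hab)]
  rw [logGap, log_exp, log_exp]
  rcases le_total b a with h | h
  · rw [max_eq_left (by linarith), max_eq_right (by linarith : b - a ≤ 0)]
    linarith [key a b h]
  · rw [max_eq_left (by linarith : 0 ≤ b - a), max_eq_right (by linarith : a - b ≤ 0)]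
    linarith [key b a h]

/-- Convexity of `exp` between `0` and `d / 2`, with weight `2t`; this is why `t` stays below `1 /
2`. -/
lemma exp_mul_sub_one_le {t d : ℝ} (ht0 : 0 ≤ t) (ht : t ≤ 1 / 2) :
    exp (t * d) - 1 ≤ 2 * t * (exp (d / 2) - 1) := by
  have := convexOn_exp.2 (Set.mem_univ (d / 2)) (Set.mem_univ 0)
    (show 0 ≤ 2 * t by linarith) (show 0 ≤ 1 - 2 * t by linarith) (by ring)
  simp only [smul_eq_mul, mul_zero, add_zero, exp_zero, mul_one] at this
  have e : 2 * t * (d / 2) = t * d := by ring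
  rw [e] at this
  linarith

/-- Iterating `s ≥ x + s² / 4` gives `s ≥ x + x² / 4 + x³ / 8`. Its square dominates `x` times the
third-order Taylor bound on `exp x - 1`: the `x²` and `x³` terms match, and at `x⁴` one has `5/16 ≥
2/9`. -/
lemma mul_exp_sub_one_le_sq {x s : ℝ} (hx : 0 ≤ x) (hxs : x ≤ s - s ^ 2 / 4) :
    x * (exp x - 1) ≤ s ^ 2 := by
  have hx1 : x ≤ 1 := by nlinarith [sq_nonneg (s - 2)]
  have h1 := exp_bound (x := x) (by rwa [abs_of_nonneg hx]) (n := 3) (by norm_num)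
  simp only [sum_range_succ, range_zero, sum_empty, abs_of_nonneg hx] at h1
  norm_num [Nat.factorial] at h1
  have h2 := (abs_le.1 h1).2
  have h3 : x ≤ s := by linarith [sq_nonneg s]
  have h4 : x + x ^ 2 / 4 ≤ s := by linarith [pow_le_pow_left₀ hx h3 2]
  have h5 : x + (x + x ^ 2 / 4) ^ 2 / 4 ≤ s := by
    linarith [pow_le_pow_left₀ (by positivity) h4 2]
  have h6 : x + x ^ 2 / 4 + x ^ 3 / 8 ≤ s := by
    have : 0 ≤ x ^ 4 := by positivity
    linarith
  have h7 := pow_le_pow_left₀ (by positivity) h6 2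
  have h8 : x * (exp x - 1) ≤ x * (x + x ^ 2 / 2 + x ^ 3 * (2 / 9)) :=
    mul_le_mul_of_nonneg_left (by linarith) hx
  have h9 : 0 ≤ x ^ 4 := by positivity
  have h10 : 0 ≤ x ^ 5 := by positivity
  have h11 : 0 ≤ x ^ 6 := by positivity
  nlinarith

lemma mul_exp_mul_sub_one_le {t d s : ℝ} (ht0 : 0 ≤ t) (ht : t ≤ 1 / 2) (hd : 0 ≤ d)
    (hds : d ≤ 2 * s - s ^ 2 / 2) : d * (exp (t * d) - 1) ≤ 4 * t * s ^ 2 := by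
  have h1 := mul_le_mul_of_nonneg_left (exp_mul_sub_one_le (d := d) ht0 ht) hd
  have h2 := mul_le_mul_of_nonneg_left
    (mul_exp_sub_one_le_sq (x := d / 2) (s := s) (by positivity) (by linarith))
    (by positivity : 0 ≤ 4 * t)
  linarith

/-- Only one of the two terms is nonzero: the weight sits at the point with the larger value, so
only decreases of `W` along an exchange matter. -/
lemma logGap_exp_neg (t u v : ℝ) :
    logGap (exp (t * -u)) (exp (t * -v))
      = t * max (u - v) 0 * (exp (t * max (u - v) 0) - 1) * exp (t * -u)
        + t * max (v - u) 0 * (exp (t * max (v - u) 0) - 1) * exp (t * -v) := by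
  have key : ∀ u v : ℝ, t * (u - v) * (exp (t * (u - v)) - 1) * exp (t * -u)
      = (exp (t * -u) - exp (t * -v)) * (t * -u - t * -v) := by
    intro u v
    have e : exp (t * -v) = exp (t * (u - v)) * exp (t * -u) := by
      rw [← exp_add]; congr 1; ring
    rw [e]
    ring
  rw [logGap, log_exp, log_exp]
  rcases le_total v u with h | h
  · rw [max_eq_left (by linarith), max_eq_right (by linarith : v - u ≤ 0), key u v]
    ring
  · rw [max_eq_left (by linarith : 0 ≤ v - u), max_eq_right (by linarith : u - v ≤ 0), key v u]
    ring

/-- Upper tails on a slice from a bound on the one-sided discrete gradient. -/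
theorem card_filter_powersetCard_le (S : Finset α) {m : ℕ} (hm : m ≤ #S) (Q : Finset α → ℝ)
    {V : ℝ} (hV : 0 < V)
    (hQ : ∀ x ∈ S.powersetCard m,
      ∑ i ∈ x, ∑ j ∈ S \ x, max (Q x - Q (swapElem x i j)) 0 ^ 2 ≤ V)
    {ε : ℝ} (hε : 0 ≤ ε) :
    (#{x ∈ S.powersetCard m | ε ≤ Q x - (∑ y ∈ S.powersetCard m, Q y) / #(S.powersetCard m)} : ℝ)
      / #(S.powersetCard m) ≤ exp (-(((#S : ℝ) + 2) * ε ^ 2 / (4 * V))) := by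
  have hS : (0 : ℝ) < #S + 2 := by positivity
  have h := card_filter_le_of_entropySum_le (powersetCard_nonempty.2 hm) Q
    (K := V / (#S + 2)) (by positivity) (fun t ht => by
      have h1 := entropySum_powersetCard_le S m (f := fun x => exp (t * Q x))
        (fun _ => exp_pos _)
      have h2 : swapSum S m (fun x y => logGap (exp (t * Q x)) (exp (t * Q y)))
          ≤ 2 * swapSum S m (fun x y => max (t * Q x - t * Q y) 0 ^ 2 * exp (t * Q x)) :=
        swapSum_le_two_mul fun _ _ => logGap_exp_le_sq _ _
      have h3 : swapSum S m (fun x y => max (t * Q x - t * Q y) 0 ^ 2 * exp (t * Q x))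
          ≤ t ^ 2 * V * ∑ x ∈ S.powersetCard m, exp (t * Q x) := by
        rw [swapSum, mul_sum]
        refine sum_le_sum fun x hx => ?_
        simp only [← sum_mul]
        refine mul_le_mul_of_nonneg_right ?_ (exp_pos _).le
        refine le_trans (le_of_eq ?_) (mul_le_mul_of_nonneg_left (hQ x hx) (sq_nonneg t))
        simp only [mul_sum]
        refine sum_congr rfl fun i _ => sum_congr rfl fun j _ => ?_
        rw [← mul_pow, mul_max_of_nonneg _ _ ht.le, mul_zero, mul_sub]
      rw [div_mul_eq_mul_div, div_mul_eq_mul_div, le_div_iff₀ hS]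
      linarith) hε
  refine h.trans (le_of_eq (congrArg exp ?_))
  field_simp

lemma sum_swapElem {x : Finset α} {i j : α} (hi : i ∈ x) (hj : j ∉ x) (g : α → ℝ) :
    ∑ c ∈ swapElem x i j, g c = ∑ c ∈ x, g c - g i + g j := by
  rw [swapElem, sum_insert (fun h => hj (mem_of_mem_erase h)), ← add_sum_erase x g hi]
  ring

/-- The indicator vector of a finite set. -/
def indVec (x : Finset α) (c : α) : ℝ := if c ∈ x then 1 else 0

lemma convexHull_indVec_subset (A : Finset (Finset α)) :
    convexHull ℝ (indVec '' (A : Set (Finset α))) ⊆ Set.Icc 0 1 := by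
  refine convexHull_min ?_ (convex_Icc 0 1)
  rintro _ ⟨x, -, rfl⟩
  constructor <;> intro c <;> by_cases h : c ∈ x <;> simp [indVec, h]

end SliceTails

/-! ### Distance to a convex hull on the slice -/

section ConvexDistance

lemma isLinearMap_sum_mul {α : Type*} [Fintype α] (g : α → ℝ) : IsLinearMap ℝ fun b : α → ℝ => ∑ c, g c * b c := by
  refine ⟨fun u v => ?_, fun r u => ?_⟩
  · simp [mul_add, sum_add_distrib]
  · simp only [Pi.smul_apply, smul_eq_mul, mul_sum]
    exact sum_congr rfl fun c _ => by ring

/-- The obtuse angle property of the nearest point of a convex set. -/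
lemma sum_mul_sub_nonneg_of_nearest {α : Type*} [Fintype α] {K : Set (α → ℝ)} (hK : Convex ℝ K) {z b b' : α → ℝ}
    (hb : b ∈ K) (hb' : b' ∈ K)
    (hmin : ∀ a ∈ K, ∑ c, (z c - b c) ^ 2 ≤ ∑ c, (z c - a c) ^ 2) :
    0 ≤ ∑ c, (z c - b c) * (b c - b' c) := by
  set I := ∑ c, (z c - b c) * (b c - b' c) with hI
  set D := ∑ c, (b c - b' c) ^ 2 with hD
  have hD0 : 0 ≤ D := sum_nonneg fun _ _ => sq_nonneg _
  have key : ∀ t : ℝ, 0 < t → t ≤ 1 → 0 ≤ 2 * I + t * D := by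
    intro t ht0 ht1
    have h1 := hmin _ (hK hb hb' (by linarith : 0 ≤ 1 - t) ht0.le (by ring))
    have e : ∀ c, (z c - ((1 - t) • b + t • b') c) ^ 2
        = (z c - b c) ^ 2 + 2 * t * ((z c - b c) * (b c - b' c)) + t ^ 2 * (b c - b' c) ^ 2 := by
      intro c
      simp only [Pi.add_apply, Pi.smul_apply, smul_eq_mul]
      ring
    simp only [e, sum_add_distrib, ← mul_sum] at h1
    rw [← hI, ← hD] at h1
    have h2 : 0 ≤ t * (2 * I + t * D) := by linarith
    exact nonneg_of_mul_nonneg_right h2 ht0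
  by_contra hneg
  push Not at hneg
  -- A step short enough for the negative first-order term to win; `D + 1` avoids dividing by zero
  -- when `b = b'`.
  have h1 := key (min 1 (-I / (D + 1))) (lt_min one_pos (div_pos (by linarith) (by linarith)))
    (min_le_left _ _)
  have h2 : min 1 (-I / (D + 1)) * D ≤ -I / (D + 1) * D :=
    mul_le_mul_of_nonneg_right (min_le_right _ _) hD0
  have h3 : -I / (D + 1) * D ≤ -I := by
    rw [div_mul_eq_mul_div, div_le_iff₀ (by linarith)]
    nlinarith
  linarith

variable {α : Type*} [Fintype α] [DecidableEq α]

lemma sum_mul_indVec (g : α → ℝ) (x : Finset α) : ∑ c, g c * indVec x c = ∑ c ∈ x, g c := by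
  simp [indVec]

lemma sum_sq_sub_swapElem {x : Finset α} {i j : α} (hi : i ∈ x) (hj : j ∉ x) (b : α → ℝ) :
    ∑ c, (indVec x c - b c) ^ 2 - ∑ c, (indVec (swapElem x i j) c - b c) ^ 2
      = 2 * (b j - b i) := by
  have hij : i ≠ j := fun e => hj (e ▸ hi)
  rw [← sum_sub_distrib]
  have : ∀ c, (indVec x c - b c) ^ 2 - (indVec (swapElem x i j) c - b c) ^ 2
      = (if c = i then 1 - 2 * b i else 0) + (if c = j then 2 * b j - 1 else 0) := by
    intro c
    by_cases h1 : c = i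
    · subst h1
      simp [indVec, swapElem, hi, hij]
      ring
    by_cases h2 : c = j
    · subst h2
      simp [indVec, swapElem, hj, h1]
      ring
    simp [indVec, swapElem, h1, h2]
  simp only [this, sum_add_distrib, sum_ite_eq', mem_univ, if_true]
  ring

lemma exists_nearest_mem_convexHull {A : Finset (Finset α)} (hA : A.Nonempty) (x : Finset α) :
    ∃ b ∈ convexHull ℝ (indVec '' (A : Set (Finset α))),
      ∀ b' ∈ convexHull ℝ (indVec '' (A : Set (Finset α))),
        ∑ c, (indVec x c - b c) ^ 2 ≤ ∑ c, (indVec x c - b' c) ^ 2 := by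
  have hne : (indVec '' (A : Set (Finset α))).Nonempty := (coe_nonempty.2 hA).image _
  obtain ⟨b, hb, hmin⟩ := ((A.finite_toSet.image indVec).isCompact_convexHull
    (𝕜 := ℝ)).exists_isMinOn hne.convexHull
    (f := fun b : α → ℝ => ∑ c, (indVec x c - b c) ^ 2) (by fun_prop)
  exact ⟨b, hb, fun b' hb' => hmin hb'⟩

/-- Total mass is a linear functional, constant on the slice. Hence `indVec x - b` is centred for
`x` in the slice, as `sum_sum_sub_sq_le` requires. -/
lemma sum_eq_of_mem_convexHull {m : ℕ} {A : Finset (Finset α)} (hA : A ⊆ univ.powersetCard m)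
    {b : α → ℝ} (hb : b ∈ convexHull ℝ (indVec '' (A : Set (Finset α)))) : ∑ c, b c = m := by
  have : convexHull ℝ (indVec '' (A : Set (Finset α))) ⊆ {b | ∑ c, (1 : α → ℝ) c * b c = m} := by
    refine convexHull_min ?_ (convex_hyperplane (isLinearMap_sum_mul 1) _)
    rintro _ ⟨x, hx, rfl⟩
    rw [Set.mem_ofPred_eq, sum_mul_indVec]
    simp [(mem_powersetCard.1 (hA hx)).2]
  simpa using this hb

/-- Exchanging one element changes the squared distance to a convex hull by a bounded amount. -/
lemma nearest_sub_nearest_swapElem_le {A : Finset (Finset α)} {b b' : α → ℝ} {x : Finset α}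
    (hb : b ∈ convexHull ℝ (indVec '' (A : Set (Finset α))))
    (hb' : b' ∈ convexHull ℝ (indVec '' (A : Set (Finset α))))
    (hmin : ∀ a ∈ convexHull ℝ (indVec '' (A : Set (Finset α))),
      ∑ c, (indVec x c - b c) ^ 2 ≤ ∑ c, (indVec x c - a c) ^ 2)
    {i j : α} (hi : i ∈ x) (hj : j ∉ x) :
    ∑ c, (indVec x c - b c) ^ 2 - ∑ c, (indVec (swapElem x i j) c - b' c) ^ 2
      ≤ 2 * (1 - b i + b j) - (1 - b i + b j) ^ 2 / 2 := by
  have hij : i ≠ j := fun e => hj (e ▸ hi)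
  have h1 := sum_sq_sub_swapElem hi hj b'
  -- The obtuse angle gains `‖b - b'‖²`, so the decrease is at most `2 (b' j - b' i) - (b i - b' i)²
  -- - (b j - b' j)²`. Over `[0, 1]` this is largest at `b' i = 0`, `b' j = 1`; then `u² + v² ≥ (u +
  -- v)² / 2` with `u = 1 - b i`, `v = b j`.
  have h2 := sum_mul_sub_nonneg_of_nearest (convex_convexHull ℝ _) hb hb' hmin
  have h3 : ∑ c, (indVec x c - b' c) ^ 2 = ∑ c, (indVec x c - b c) ^ 2
      + 2 * ∑ c, (indVec x c - b c) * (b c - b' c) + ∑ c, (b c - b' c) ^ 2 := by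
    rw [mul_sum, ← sum_add_distrib, ← sum_add_distrib]
    exact sum_congr rfl fun c _ => by ring
  have h4 : (b i - b' i) ^ 2 + (b j - b' j) ^ 2 ≤ ∑ c, (b c - b' c) ^ 2 := by
    rw [← sum_pair hij (f := fun c => (b c - b' c) ^ 2)]
    exact sum_le_sum_of_subset_of_nonneg (subset_univ _) fun _ _ _ => sq_nonneg _
  obtain ⟨l, u⟩ := convexHull_indVec_subset A hb
  obtain ⟨l', u'⟩ := convexHull_indVec_subset A hb'
  have h5 : 0 ≤ b' i * (1 - b i) := mul_nonneg (l' i) (sub_nonneg.2 (u i))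
  have h6 : 0 ≤ b j * (1 - b' j) := mul_nonneg (l j) (sub_nonneg.2 (u' j))
  have h7 := sq_nonneg (b' i)
  have h8 := sq_nonneg (1 - b' j)
  have h9 := sq_nonneg (1 - b i - b j)
  nlinarith

/-- For centred `g` the sum over all unordered pairs equals `N ∑ g²`. Here the pairs inside `x` and
inside its complement are dropped, via Cauchy–Schwarz on each part. -/
lemma sum_sum_sub_sq_le {g : α → ℝ} (hg : ∑ c, g c = 0) (x : Finset α) :
    ∑ i ∈ x, ∑ j ∈ univ \ x, (g i - g j) ^ 2 ≤ Fintype.card α * ∑ c, g c ^ 2 := by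
  have h1 : (∑ j ∈ univ \ x, g j) = -∑ i ∈ x, g i := by
    rw [← sum_sdiff (subset_univ x)] at hg; linarith
  have h2 := sq_sum_le_card_mul_sum_sq (s := x) (f := g)
  have h3 := sq_sum_le_card_mul_sum_sq (s := univ \ x) (f := g)
  have h4 : (#(univ \ x) : ℝ) = Fintype.card α - #x := by
    rw [cast_card_sdiff (subset_univ x), card_univ]
  rw [h1, h4] at h3
  rw [← sum_sdiff (subset_univ x) (f := fun c => g c ^ 2)]
  have h5 : ∑ i ∈ x, ∑ j ∈ univ \ x, (g i - g j) ^ 2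
      = (Fintype.card α - #x) * ∑ i ∈ x, g i ^ 2 + #x * ∑ j ∈ univ \ x, g j ^ 2
        - 2 * ((∑ i ∈ x, g i) * ∑ j ∈ univ \ x, g j) := by
    rw [sum_mul_sum]
    simp only [sub_sq, sum_add_distrib, sum_sub_distrib, sum_const, nsmul_eq_mul, h4, mul_sum,
      mul_assoc]
    ring
  rw [h5, h1]
  nlinarith

/-- A convex distance inequality on the slice: the average squared Euclidean distance of a point
to the convex hull of `A` is large when `A` is small. -/
theorem card_div_card_powersetCard_le {m : ℕ} (hN : 2 ≤ Fintype.card α)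
    (hm : m ≤ Fintype.card α) {A : Finset (Finset α)} (hA : A ⊆ univ.powersetCard m)
    {b : Finset α → α → ℝ}
    (hb : ∀ x, b x ∈ convexHull ℝ (indVec '' (A : Set (Finset α))))
    (hmin : ∀ x, ∀ b' ∈ convexHull ℝ (indVec '' (A : Set (Finset α))),
        ∑ c, (indVec x c - b x c) ^ 2 ≤ ∑ c, (indVec x c - b' c) ^ 2) :
    (#A : ℝ) / #(univ.powersetCard m : Finset (Finset α))
      ≤ exp (-(((Fintype.card α : ℝ) + 2) / (8 * Fintype.card α)
        * ((∑ x ∈ univ.powersetCard m, ∑ c, (indVec x c - b x c) ^ 2)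
          / #(univ.powersetCard m : Finset (Finset α))))) := by
  obtain ⟨W, hW⟩ : ∃ W : Finset α → ℝ, ∀ x, W x = ∑ c, (indVec x c - b x c) ^ 2 :=
    ⟨_, fun _ => rfl⟩
  simp only [← hW] at hmin ⊢
  set N : ℝ := (Fintype.card α : ℝ) with hNdef
  have hN2 : 2 ≤ N := by rw [hNdef]; exact_mod_cast hN
  have hb01 : ∀ x c, b x c ∈ Set.Icc (0 : ℝ) 1 := fun x c => by
    have := convexHull_indVec_subset A (hb x)
    exact ⟨this.1 c, this.2 c⟩
  have hW0 : ∀ x, 0 ≤ W x := fun x => hW x ▸ sum_nonneg fun _ _ => sq_nonneg _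
  have hWA : ∀ x ∈ A, W x = 0 := fun x hx => by
    refine le_antisymm ((hmin x (indVec x) (subset_convexHull ℝ _ ⟨x, hx, rfl⟩)).trans ?_) (hW0 x)
    simp
  have hΩ : (univ.powersetCard m : Finset (Finset α)).Nonempty :=
    powersetCard_nonempty.2 (by simpa using hm)
  have main := card_zero_le_of_entropySum_le hΩ W (κ := 4 * N / (N + 2)) (T := 1 / 2)
    (by positivity) (by norm_num) (fun t ht => by
    have h1 := entropySum_powersetCard_le univ m (f := fun x => exp (t * -W x))
      (fun _ => exp_pos _)
    have h2 := swapSum_le_two_mul (S := univ) (m := m)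
      fun x y => (logGap_exp_neg t (W x) (W y)).le
    have h3 : swapSum univ m (fun x y => t * max (W x - W y) 0
        * (exp (t * max (W x - W y) 0) - 1) * exp (t * -W x))
        ≤ 4 * t ^ 2 * N * ∑ x ∈ univ.powersetCard m, W x * exp (t * -W x) := by
      rw [swapSum, mul_sum]
      refine sum_le_sum fun x hx => ?_
      simp only [← sum_mul]
      rw [← mul_assoc]
      refine mul_le_mul_of_nonneg_right ?_ (exp_pos _).le
      have hsum : ∑ c, (indVec x c - b x c) = 0 := by
        have h4 := sum_mul_indVec (1 : α → ℝ) x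
        simp only [Pi.one_apply, one_mul, sum_const, nsmul_eq_mul, mul_one,
          (mem_powersetCard.1 hx).2] at h4
        rw [sum_sub_distrib, h4, sum_eq_of_mem_convexHull hA (hb x), sub_self]
      calc ∑ i ∈ x, ∑ j ∈ univ \ x, t * max (W x - W (swapElem x i j)) 0
            * (exp (t * max (W x - W (swapElem x i j)) 0) - 1)
          ≤ ∑ i ∈ x, ∑ j ∈ univ \ x, 4 * t ^ 2
            * ((indVec x i - b x i) - (indVec x j - b x j)) ^ 2 := by
            refine sum_le_sum fun i hi => sum_le_sum fun j hj => ?_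
            have hj' := (mem_sdiff.1 hj).2
            have e : (indVec x i - b x i) - (indVec x j - b x j) = 1 - b x i + b x j := by
              simp [indVec, hi, hj']
            have hs0 : 0 ≤ 1 - b x i + b x j := by linarith [(hb01 x i).2, (hb01 x j).1]
            have hs2 : 1 - b x i + b x j ≤ 2 := by linarith [(hb01 x i).1, (hb01 x j).2]
            rw [e]
            have h5 : max (W x - W (swapElem x i j)) 0
                ≤ 2 * (1 - b x i + b x j) - (1 - b x i + b x j) ^ 2 / 2 := by
              refine max_le ?_ (by nlinarith)
              rw [hW, hW]
              exact nearest_sub_nearest_swapElem_le (hb x) (hb _)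
                (fun a ha => hW x ▸ hmin x a ha) hi hj'
            have h6 := mul_le_mul_of_nonneg_left
              (mul_exp_mul_sub_one_le ht.1.le ht.2.le (le_max_right _ _) h5) ht.1.le
            linarith
        _ = 4 * t ^ 2 * ∑ i ∈ x, ∑ j ∈ univ \ x,
            ((indVec x i - b x i) - (indVec x j - b x j)) ^ 2 := by simp only [mul_sum]
        _ ≤ 4 * t ^ 2 * (N * W x) := by
            rw [hW x]
            exact mul_le_mul_of_nonneg_left (sum_sum_sub_sq_le hsum x) (by positivity)
        _ = 4 * t ^ 2 * N * W x := by ring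
    rw [card_univ, ← hNdef] at h1
    rw [div_mul_eq_mul_div, div_mul_eq_mul_div, le_div_iff₀ (by linarith)]
    linarith)
  calc (#A : ℝ) / #(univ.powersetCard m : Finset (Finset α))
      ≤ (#{x ∈ (univ.powersetCard m : Finset (Finset α)) | W x = 0} : ℝ)
        / #(univ.powersetCard m : Finset (Finset α)) := by
        gcongr
        exact fun x hx => mem_filter.2 ⟨hA hx, hWA x hx⟩
    _ ≤ _ := main
    _ ≤ _ := by
        refine exp_le_exp.2 (neg_le_neg ?_)
        have hw : 0 ≤ (∑ x ∈ univ.powersetCard m, W x)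
            / #(univ.powersetCard m : Finset (Finset α)) :=
          div_nonneg (sum_nonneg fun x _ => hW0 x) (Nat.cast_nonneg _)
        -- With `T = 1 / 2` the rate `T / (1 + κ T)` equals `(N + 2) / (2 (3N + 2))`, which is at
        -- least `(N + 2) / (8N)` exactly when `N ≥ 2`.
        rw [mul_div_right_comm]
        refine mul_le_mul_of_nonneg_right ?_ hw
        rw [div_le_div_iff₀ (by positivity) (by positivity)]
        field_simp
        nlinarith

end ConvexDistance

/-! ### Tails for suprema of linear functionals -/

section LinearClass

/-- The supremum over the class `F` of the sums over the set `x`. -/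
noncomputable def setSup {α : Type*} (F : Set (α → ℝ)) (x : Finset α) : ℝ :=
  ⨆ f : F, ∑ c ∈ x, (f : α → ℝ) c

lemma bddAbove_setSup {α : Type*} {F : Set (α → ℝ)} (hF1 : ∀ f ∈ F, ∀ c, f c ≤ 1) (x : Finset α) :
    BddAbove (Set.range fun f : F => ∑ c ∈ x, (f : α → ℝ) c) := by
  refine ⟨#x, ?_⟩
  rintro _ ⟨f, rfl⟩
  simpa using sum_le_card_nsmul x (f : α → ℝ) 1 fun c _ => hF1 f f.2 c

variable {α : Type*} [Fintype α] [DecidableEq α]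

variable {F : Set (α → ℝ)}

lemma sum_sum_setSup_sub_sq_le (hne : F.Nonempty) (hF1 : ∀ f ∈ F, ∀ c, f c ∈ Set.Icc (-1 : ℝ) 1)
    (hF0 : ∀ f ∈ F, ∑ c, f c = 0) {V : ℝ} (hFV : ∀ f ∈ F, ∑ c, f c ^ 2 ≤ V) (x : Finset α) :
    ∑ i ∈ x, ∑ j ∈ univ \ x, max (setSup F x - setSup F (swapElem x i j)) 0 ^ 2
      ≤ Fintype.card α * V := by
  have : Nonempty F := hne.to_subtype
  have hbdd := bddAbove_setSup fun f hf c => (hF1 f hf c).2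
  -- The supremum need not be attained, so a `δ`-maximiser at `x` is used for all exchanges at once.
  -- The bound `|f i - f j| ≤ 2` controls the cross term, and `δ → 0` at the end.
  have hδ : ∀ δ : ℝ, 0 < δ →
      ∑ i ∈ x, ∑ j ∈ univ \ x, max (setSup F x - setSup F (swapElem x i j)) 0 ^ 2
        ≤ Fintype.card α * V + #x * (#(univ \ x) * (4 * δ + δ ^ 2)) := by
    intro δ hδ
    obtain ⟨f, hf⟩ := exists_lt_of_lt_ciSup (sub_lt_self (setSup F x) hδ)
    calc _ ≤ ∑ i ∈ x, ∑ j ∈ univ \ x, (((f : α → ℝ) i - (f : α → ℝ) j) ^ 2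
            + (4 * δ + δ ^ 2)) := by
          refine sum_le_sum fun i hi => sum_le_sum fun j hj => ?_
          have h1 := le_ciSup (hbdd (swapElem x i j)) f
          rw [sum_swapElem hi (mem_sdiff.1 hj).2] at h1
          change _ ≤ setSup F (swapElem x i j) at h1
          have h2 : max (setSup F x - setSup F (swapElem x i j)) 0
              ≤ |(f : α → ℝ) i - (f : α → ℝ) j| + δ :=
            max_le (by linarith [le_abs_self ((f : α → ℝ) i - (f : α → ℝ) j)]) (by positivity)
          have h3 : |(f : α → ℝ) i - (f : α → ℝ) j| ≤ 2 := by
            have := hF1 f f.2 i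
            have := hF1 f f.2 j
            simp only [Set.mem_Icc] at *
            exact abs_le.2 ⟨by linarith, by linarith⟩
          have h4 := pow_le_pow_left₀ (le_max_right _ _) h2 2
          rw [add_sq, sq_abs] at h4
          nlinarith
      _ = ∑ i ∈ x, ∑ j ∈ univ \ x, ((f : α → ℝ) i - (f : α → ℝ) j) ^ 2
            + #x * (#(univ \ x) * (4 * δ + δ ^ 2)) := by
          simp only [sum_add_distrib, sum_const, nsmul_eq_mul]
          ring
      _ ≤ _ := by
          gcongr
          exact (sum_sum_sub_sq_le (hF0 f f.2) x).trans
            (mul_le_mul_of_nonneg_left (hFV f f.2) (Nat.cast_nonneg _))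
  have hlim : Filter.Tendsto (fun δ : ℝ => (Fintype.card α : ℝ) * V
      + #x * (#(univ \ x) * (4 * δ + δ ^ 2))) (nhdsWithin 0 (Set.Ioi 0))
      (nhds (Fintype.card α * V)) := by
    have h : Continuous fun δ : ℝ => (Fintype.card α : ℝ) * V
      + #x * (#(univ \ x) * (4 * δ + δ ^ 2)) := by fun_prop
    have := h.tendsto 0
    simp only [mul_zero, ne_eq, OfNat.ofNat_ne_zero, not_false_eq_true, zero_pow, add_zero] at this
    exact this.mono_left nhdsWithin_le_nhds
  refine ge_of_tendsto hlim ?_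
  filter_upwards [self_mem_nhdsWithin] with δ h using hδ δ h

/-- Each `f` is linear, so its bound `q` on `A` passes to the hull; Cauchy–Schwarz pays for moving
from `b` to `x`. -/
lemma setSup_le_add_sqrt (hne : F.Nonempty) (hF1 : ∀ f ∈ F, ∀ c, f c ≤ 1) {V : ℝ}
    (hFV : ∀ f ∈ F, ∑ c, f c ^ 2 ≤ V) {A : Finset (Finset α)} {q : ℝ}
    (hq : ∀ z ∈ A, setSup F z ≤ q) {b : α → ℝ}
    (hb : b ∈ convexHull ℝ (indVec '' (A : Set (Finset α)))) (x : Finset α) :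
    setSup F x ≤ q + √V * √(∑ c, (indVec x c - b c) ^ 2) := by
  have : Nonempty F := hne.to_subtype
  refine ciSup_le fun f => ?_
  have h1 : ∑ c, (f : α → ℝ) c * b c ≤ q := by
    refine convexHull_min ?_ (convex_halfSpace_le (isLinearMap_sum_mul (f : α → ℝ)) q) hb
    rintro _ ⟨z, hz, rfl⟩
    rw [Set.mem_ofPred_eq, sum_mul_indVec]
    exact (le_ciSup (bddAbove_setSup hF1 z) f).trans (hq z hz)
  have h2 := sum_mul_le_sqrt_mul_sqrt univ (f : α → ℝ) (fun c => indVec x c - b c)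
  have h3 : ∑ c, (f : α → ℝ) c * (indVec x c - b c)
      = ∑ c ∈ x, (f : α → ℝ) c - ∑ c, (f : α → ℝ) c * b c := by
    simp only [mul_sub, sum_sub_distrib, sum_mul_indVec]
  have h4 : √(∑ c, (f : α → ℝ) c ^ 2) * √(∑ c, (indVec x c - b c) ^ 2)
      ≤ √V * √(∑ c, (indVec x c - b c) ^ 2) := by
    gcongr
    exact hFV f f.2
  linarith

theorem setSup_upper_tail (hne : F.Nonempty) (hF1 : ∀ f ∈ F, ∀ c, f c ∈ Set.Icc (-1 : ℝ) 1)
    (hF0 : ∀ f ∈ F, ∑ c, f c = 0) {V : ℝ} (hV : 0 < V) (hFV : ∀ f ∈ F, ∑ c, f c ^ 2 ≤ V)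
    {m : ℕ} (hm0 : 0 < m) (hm : m ≤ Fintype.card α) {ε : ℝ} (hε : 0 ≤ ε) :
    (#{x ∈ (univ.powersetCard m : Finset (Finset α)) | ε ≤ setSup F x
        - (∑ y ∈ univ.powersetCard m, setSup F y) / #(univ.powersetCard m : Finset (Finset α))} : ℝ)
      / #(univ.powersetCard m : Finset (Finset α))
      ≤ exp (-(((Fintype.card α : ℝ) + 2) * ε ^ 2 / (8 * (Fintype.card α * V)))) := by
  have hN : (0 : ℝ) < Fintype.card α := by exact_mod_cast hm0.trans_le hm
  have := card_filter_powersetCard_le univ (by simpa using hm) (setSup F) (mul_pos hN hV)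
    (fun x _ => sum_sum_setSup_sub_sq_le hne hF1 hF0 hFV x) hε
  rw [card_univ] at this
  refine this.trans (exp_le_exp.2 (neg_le_neg ?_))
  -- The argument gives the constant `4`; it is relaxed to `8` to match the lower tail.
  gcongr
  norm_num

theorem setSup_lower_tail (hne : F.Nonempty) (hF1 : ∀ f ∈ F, ∀ c, f c ≤ 1)
    {V : ℝ} (hV : 0 < V) (hFV : ∀ f ∈ F, ∑ c, f c ^ 2 ≤ V) (hN : 2 ≤ Fintype.card α)
    {m : ℕ} (hm : m ≤ Fintype.card α) {ε : ℝ} (hε : 0 ≤ ε) :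
    (#{x ∈ (univ.powersetCard m : Finset (Finset α)) | ε ≤ (∑ y ∈ univ.powersetCard m, setSup F y)
        / #(univ.powersetCard m : Finset (Finset α)) - setSup F x} : ℝ)
      / #(univ.powersetCard m : Finset (Finset α))
      ≤ exp (-(((Fintype.card α : ℝ) + 2) * ε ^ 2 / (8 * (Fintype.card α * V)))) := by
  set Ω := (univ.powersetCard m : Finset (Finset α)) with hΩ
  set a := (∑ y ∈ Ω, setSup F y) / #Ω with ha
  set A := {x ∈ Ω | ε ≤ a - setSup F x} with hA
  rcases A.eq_empty_or_nonempty with h | h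
  · rw [h, card_empty, Nat.cast_zero, zero_div]
    exact (exp_pos _).le
  have hcard : (0 : ℝ) < #Ω := by
    exact_mod_cast (powersetCard_nonempty.2 (by simpa using hm) : Ω.Nonempty).card_pos
  choose b hb hmin using exists_nearest_mem_convexHull h
  refine (card_div_card_powersetCard_le hN hm (filter_subset _ _) hb hmin).trans ?_
  rw [← hΩ]
  obtain ⟨W, hW⟩ : ∃ W : Finset α → ℝ, ∀ x, W x = ∑ c, (indVec x c - b x c) ^ 2 :=
    ⟨_, fun _ => rfl⟩
  simp only [← hW]
  have hW0 : ∀ x, 0 ≤ W x := fun x => hW x ▸ sum_nonneg fun _ _ => sq_nonneg _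
  have h1 : ∀ x ∈ Ω, setSup F x ≤ a - ε + √V * √(W x) := fun x _ =>
    hW x ▸ setSup_le_add_sqrt hne hF1 hFV (fun z hz => by linarith [(mem_filter.1 hz).2]) (hb x) x
  have h2 := sum_le_sum h1
  rw [sum_add_distrib, sum_const, nsmul_eq_mul, ← mul_sum] at h2
  have h3 : ∑ x ∈ Ω, setSup F x = #Ω * a := by
    rw [ha, mul_div_cancel₀ _ hcard.ne']
  have h4 : #Ω * ε ≤ √V * ∑ x ∈ Ω, √(W x) := by linarith
  have h5 := sq_sum_le_card_mul_sum_sq (s := Ω) (f := fun x => √(W x))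
  -- Cauchy–Schwarz on the average of `√W` gives `ε² ≤ V 𝔼W`, the input for the convex distance
  -- inequality.
  rw [sum_congr rfl fun x _ => sq_sqrt (hW0 x)] at h5
  have h6 : (#Ω * ε) ^ 2 ≤ V * (#Ω * ∑ x ∈ Ω, W x) := by
    refine (pow_le_pow_left₀ (mul_nonneg hcard.le hε) h4 2).trans ?_
    rw [mul_pow, sq_sqrt hV.le]
    exact mul_le_mul_of_nonneg_left h5 hV.le
  have h7 : ε ^ 2 / V ≤ (∑ x ∈ Ω, W x) / #Ω := by
    rw [div_le_div_iff₀ hV hcard]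
    refine le_of_mul_le_mul_left ?_ hcard
    linarith
  refine exp_le_exp.2 (neg_le_neg ?_)
  have hNpos : (0 : ℝ) < Fintype.card α := by exact_mod_cast (by omega : 0 < Fintype.card α)
  calc ((Fintype.card α : ℝ) + 2) * ε ^ 2 / (8 * (Fintype.card α * V))
      = ((Fintype.card α : ℝ) + 2) / (8 * Fintype.card α) * (ε ^ 2 / V) := by field_simp
    _ ≤ _ := mul_le_mul_of_nonneg_left h7 (by positivity)

end LinearClass

/-! ### From samples without replacement to uniform subsets -/

section Sampling

lemma IsSampleWithoutReplacement.ae_injective {Ω C : Type*} [MeasurableSpace Ω] {P : Measure Ω}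
    [Finite C] [MeasurableSpace C] [DiscreteMeasurableSpace C] {m : ℕ} {Z : Fin m → Ω → C}
    (hZ : IsSampleWithoutReplacement Z P) : ∀ᵐ ω ∂P, Function.Injective fun i => Z i ω := by
  have hmeas : Measurable fun ω i => Z i ω := measurable_pi_lambda _ hZ.measurable
  have : ∀ᵐ z ∂P.map (fun ω i => Z i ω), Function.Injective z := by
    rw [hZ.law, uniformOn]
    exact ae_cond_mem MeasurableSet.of_discrete
  exact ae_of_ae_map hmeas.aemeasurable this

variable {C : Type*} [Fintype C] [DecidableEq C] {m : ℕ}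

/-- The number of enumerations of an `m`-element set. -/
lemma card_filter_injective_image_eq {x : Finset C} (hx : #x = m) :
    #{z : Fin m → C | Function.Injective z ∧ univ.image z = x} = m.factorial := by
  have h : ({z : Fin m → C | Function.Injective z ∧ univ.image z = x} : Finset (Fin m → C))
      = (univ : Finset (Fin m ↪ x)).image fun e i => (e i : C) := by
    ext z
    simp only [mem_filter, mem_univ, true_and, mem_image]
    constructor
    · rintro ⟨hz, rfl⟩
      exact ⟨⟨fun i => ⟨z i, mem_image_of_mem z (mem_univ i)⟩, fun i j hij =>
        hz (congrArg Subtype.val hij)⟩, rfl⟩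
    · rintro ⟨e, rfl⟩
      have hinj : Function.Injective fun i => (e i : C) :=
        Subtype.val_injective.comp e.injective
      refine ⟨hinj, eq_of_subset_of_card_le (fun c hc => ?_) ?_⟩
      · obtain ⟨i, -, rfl⟩ := mem_image.1 hc
        exact (e i).2
      · rw [card_image_of_injective _ hinj, hx, card_univ, Fintype.card_fin]
  rw [h, card_image_of_injective, card_univ, Fintype.card_embedding_eq, Fintype.card_coe, hx,
    Fintype.card_fin, Nat.descFactorial_self]
  intro e e' hee
  ext i
  exact congrFun hee i

lemma sum_injective_image (G : Finset C → ℝ) :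
    ∑ z : Fin m → C with Function.Injective z, G (univ.image z)
      = m.factorial * ∑ x ∈ univ.powersetCard m, G x := by
  rw [← sum_fiberwise_of_maps_to (t := univ.powersetCard m) (g := fun z => univ.image z)
    fun z hz => ?_, mul_sum]
  · refine sum_congr rfl fun x hx => ?_
    rw [filter_filter, sum_congr rfl (g := fun _ => G x) fun z hz => by
      rw [(mem_filter.1 hz).2.2], sum_const,
      card_filter_injective_image_eq (mem_powersetCard.1 hx).2, nsmul_eq_mul]
  · rw [mem_powersetCard, card_image_of_injective _ (mem_filter.1 hz).2, card_univ,
      Fintype.card_fin]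
    exact ⟨subset_univ _, rfl⟩

lemma card_injective : (#{z : Fin m → C | Function.Injective z} : ℝ)
    = m.factorial * #(univ.powersetCard m : Finset (Finset C)) := by
  simpa using sum_injective_image (C := C) (m := m) fun _ => 1

/-- Postcomposing with the transposition of `c` and `d` is a bijection; it makes each single draw
uniform. -/
lemma card_filter_injective_apply_eq (i : Fin m) (c d : C) :
    #{z : Fin m → C | Function.Injective z ∧ z i = c}
      = #{z : Fin m → C | Function.Injective z ∧ z i = d} := by
  refine card_equiv ((Equiv.refl (Fin m)).arrowCongr (Equiv.swap c d)) fun z => ?_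
  simp only [mem_filter, mem_univ, true_and]
  change _ ↔ Function.Injective (Equiv.swap c d ∘ z) ∧ Equiv.swap c d (z i) = d
  rw [(Equiv.swap c d).injective.of_comp_iff, ← Equiv.eq_symm_apply, Equiv.symm_swap,
    Equiv.swap_apply_right]

lemma card_mul_sum_injective_apply (i : Fin m) (g : C → ℝ) :
    (Fintype.card C : ℝ) * ∑ z : Fin m → C with Function.Injective z, g (z i)
      = #{z : Fin m → C | Function.Injective z} * ∑ c, g c := by
  have h : ∀ g : C → ℝ, ∑ z : Fin m → C with Function.Injective z, g (z i)
      = ∑ c, #{z : Fin m → C | Function.Injective z ∧ z i = c} * g c := by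
    intro g
    rw [← sum_fiberwise_of_maps_to (t := univ) (g := fun z : Fin m → C => z i)
      fun z _ => mem_univ _]
    refine sum_congr rfl fun c _ => ?_
    rw [filter_filter, sum_congr rfl (g := fun _ => g c) fun z hz => by
      rw [(mem_filter.1 hz).2.2], sum_const, nsmul_eq_mul]
  rcases isEmpty_or_nonempty C with hC | ⟨⟨d⟩⟩
  · simp
  have h1 := h fun _ => 1
  have h2 := h g
  simp only [card_filter_injective_apply_eq i _ d] at h1 h2
  rw [← mul_sum] at h2
  simp only [sum_const, nsmul_eq_mul, mul_one, card_univ] at h1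
  rw [h2, h1]
  ring

variable {Ω : Type*} [MeasurableSpace Ω] {P : Measure Ω} [MeasurableSpace C]
  [DiscreteMeasurableSpace C] {Z : Fin m → Ω → C}

lemma IsSampleWithoutReplacement.integral_comp (hZ : IsSampleWithoutReplacement Z P)
    (h : (Fin m → C) → ℝ) :
    ∫ ω, h (fun i => Z i ω) ∂P = (∑ z : Fin m → C with Function.Injective z, h z)
      / #{z : Fin m → C | Function.Injective z} := by
  have hmeas : Measurable fun ω i => Z i ω := measurable_pi_lambda _ hZ.measurable
  rw [← integral_map (φ := fun ω i => Z i ω) (f := h) hmeas.aemeasurable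
    (Measurable.of_discrete).aestronglyMeasurable, hZ.law, integral_fintype (by simp)]
  rw [sum_filter, sum_div]
  refine sum_congr rfl fun z _ => ?_
  have hS : {z : Fin m → C | Function.Injective z}
      = (({z : Fin m → C | Function.Injective z} : Finset (Fin m → C)) : Set (Fin m → C)) := by
    ext; simp
  rw [measureReal_def, uniformOn, cond_apply (MeasurableSet.of_discrete), hS,
    Measure.count_apply_finset]
  split_ifs with hz
  · have : ((({z : Fin m → C | Function.Injective z} : Finset (Fin m → C)) : Set (Fin m → C))
        ∩ {z}) = {z} := by
      ext w; simp; rintro rfl; exact hz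
    rw [this, Measure.count_singleton]
    simp
    ring
  · have : ((({z : Fin m → C | Function.Injective z} : Finset (Fin m → C)) : Set (Fin m → C))
        ∩ {z}) = ∅ := by
      ext w; simp; rintro h rfl; exact hz h
    rw [this]
    simp

lemma IsSampleWithoutReplacement.integral_image (hZ : IsSampleWithoutReplacement Z P)
    (G : Finset C → ℝ) :
    ∫ ω, G (univ.image fun i => Z i ω) ∂P = (∑ x ∈ univ.powersetCard m, G x)
      / #(univ.powersetCard m : Finset (Finset C)) := by
  rw [hZ.integral_comp fun z => G (univ.image z), sum_injective_image, card_injective,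
    mul_div_mul_left _ _ (by positivity)]

lemma IsSampleWithoutReplacement.integral_apply (hZ : IsSampleWithoutReplacement Z P)
    (hm : m ≤ Fintype.card C) (i : Fin m) (g : C → ℝ) :
    ∫ ω, g (Z i ω) ∂P = (∑ c, g c) / Fintype.card C := by
  have h1 : (0 : ℝ) < #(univ.powersetCard m : Finset (Finset C)) := by
    exact_mod_cast (powersetCard_nonempty.2 (by simpa using hm)).card_pos
  have h2 : (0 : ℝ) < Fintype.card C := by exact_mod_cast i.pos.trans_le hm
  have h3 : (0 : ℝ) < #{z : Fin m → C | Function.Injective z} := by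
    rw [card_injective]; positivity
  rw [hZ.integral_comp fun z => g (z i), div_eq_div_iff h3.ne' h2.ne', mul_comm,
    card_mul_sum_injective_apply, mul_comm]

lemma IsSampleWithoutReplacement.measureReal_image (hZ : IsSampleWithoutReplacement Z P)
    (p : Finset C → Prop) [DecidablePred p] :
    P.real {ω | p (univ.image fun i => Z i ω)} = (#{x ∈ univ.powersetCard m | p x} : ℝ)
      / #(univ.powersetCard m : Finset (Finset C)) := by
  have hmeas : Measurable fun ω i => Z i ω := measurable_pi_lambda _ hZ.measurable
  have hs : MeasurableSet {ω | p (univ.image fun i => Z i ω)} :=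
    hmeas (MeasurableSet.of_discrete (s := {z : Fin m → C | p (univ.image z)}))
  have := hZ.integral_image fun x => if p x then 1 else 0
  rw [← integral_indicator_one hs]
  simp only [sum_boole] at this
  rw [← this]
  refine integral_congr_ae (Filter.Eventually.of_forall fun ω => ?_)
  simp [Set.indicator_apply]

/-- Only almost sure: where the tuple has repetitions, its image forgets multiplicities. -/
lemma IsSampleWithoutReplacement.empiricalSup_ae_eq (hZ : IsSampleWithoutReplacement Z P)
    (F : Set (C → ℝ)) :
    empiricalSup F Z =ᵐ[P] fun ω => setSup F (univ.image fun i => Z i ω) := by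
  filter_upwards [hZ.ae_injective] with ω hω
  simp only [empiricalSup, setSup]
  congr 1
  ext f
  rw [sum_image fun i _ j _ h => hω h]

end Sampling

/-! ### Assembly -/

theorem mainTheorem3 {Ω C : Type*} [MeasurableSpace Ω] (P : Measure Ω) [IsProbabilityMeasure P]
    [Fintype C] [MeasurableSpace C] [DiscreteMeasurableSpace C]
    (N m : ℕ) (hN : Fintype.card C = N) (hm : 0 < m) (hmN : m ≤ N)
    (Z : Fin m → Ω → C) (hZ : IsSampleWithoutReplacement Z P)
    (F : Set (C → ℝ)) (hFne : F.Nonempty) (hFc : F.Countable)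
    (hFmean : ∀ f ∈ F, ∫ ω, f (Z ⟨0, hm⟩ ω) ∂P = 0)
    (hFbdd : ∀ f ∈ F, ∀ x : C, f x ∈ Set.Icc (-1 : ℝ) 1)
    (σ : ℝ) (hσ0 : 0 ≤ σ) (hσ : σ ^ 2 = supVariance F (Z ⟨0, hm⟩) P) :
    -- the two tail bounds
    (0 < σ → ∀ ε : ℝ, 0 ≤ ε →
      P.real {ω | empiricalSup F Z ω - ∫ ω', empiricalSup F Z ω' ∂P ≥ ε}
        ≤ Real.exp (-(((N : ℝ) + 2) * ε ^ 2 / (8 * (N : ℝ) ^ 2 * σ ^ 2))) ∧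
      P.real {ω | (∫ ω', empiricalSup F Z ω' ∂P) - empiricalSup F Z ω ≥ ε}
        ≤ Real.exp (-(((N : ℝ) + 2) * ε ^ 2 / (8 * (N : ℝ) ^ 2 * σ ^ 2)))) ∧
    -- the comparison with the simpler bound
    (0 < σ → ∀ ε : ℝ, 0 < ε →
      Real.exp (-(((N : ℝ) + 2) * ε ^ 2 / (8 * (N : ℝ) ^ 2 * σ ^ 2)))
        < Real.exp (-(ε ^ 2 / (8 * (N : ℝ) * σ ^ 2)))) ∧
    -- the degenerate case, where the bound reads `exp (-∞) = 0`
    (σ = 0 → ∀ ε : ℝ, 0 < ε →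
      P.real {ω | empiricalSup F Z ω - ∫ ω', empiricalSup F Z ω' ∂P ≥ ε} = 0 ∧
      P.real {ω | (∫ ω', empiricalSup F Z ω' ∂P) - empiricalSup F Z ω ≥ ε} = 0) ∧
    -- the deviation bound
    (∀ t : ℝ, 0 ≤ t →
      P.real {ω | empiricalSup F Z ω
          ≤ (∫ ω', empiricalSup F Z ω' ∂P) + 2 * √(2 * (N : ℝ) * σ ^ 2 * t)}
        > 1 - Real.exp (-t)) := by
  classical
  have hmC : m ≤ Fintype.card C := hN ▸ hmN
  have hNC : (Fintype.card C : ℝ) = N := by rw [hN]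
  have hN0 : (0 : ℝ) < N := by exact_mod_cast hm.trans_le hmN
  have hF0 : ∀ f ∈ F, ∑ c, f c = 0 := by
    intro f hf
    have h := hFmean f hf
    rw [hZ.integral_apply hmC, hNC, div_eq_zero_iff] at h
    exact h.resolve_right hN0.ne'
  have hvar : ∀ f ∈ F, variance (fun ω => f (Z ⟨0, hm⟩ ω)) P = (∑ c, f c ^ 2) / N := by
    intro f hf
    have hmeas : Measurable fun ω => f (Z ⟨0, hm⟩ ω) :=
      Measurable.of_discrete.comp (hZ.measurable _)
    rw [variance_of_integral_eq_zero hmeas.aemeasurable (hFmean f hf), ← hNC]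
    exact hZ.integral_apply hmC ⟨0, hm⟩ fun c => f c ^ 2
  have hFV : ∀ f ∈ F, ∑ c, f c ^ 2 ≤ N * σ ^ 2 := by
    intro f hf
    have hb : BddAbove (Set.range fun f : F => variance (fun ω => (f : C → ℝ) (Z ⟨0, hm⟩ ω)) P) := by
      refine ⟨1, ?_⟩
      rintro _ ⟨g, rfl⟩
      dsimp only
      rw [hvar g g.2, div_le_one hN0, ← hNC]
      have := sum_le_card_nsmul univ (fun c => (g : C → ℝ) c ^ 2) 1 fun c _ => by
        have := hFbdd g g.2 c
        exact sq_le_one_iff_abs_le_one _ |>.2 (abs_le.2 this)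
      simpa using this
    have h := le_ciSup hb ⟨f, hf⟩
    dsimp only at h
    rw [hvar f hf, div_le_iff₀ hN0] at h
    rw [hσ, mul_comm]
    exact h
  have hae := hZ.empiricalSup_ae_eq F
  have hE := (integral_congr_ae hae).trans (hZ.integral_image (setSup F))
  have hU : ∀ ε : ℝ, P.real {ω | empiricalSup F Z ω - ∫ ω', empiricalSup F Z ω' ∂P ≥ ε}
      = (#{x ∈ (univ.powersetCard m : Finset (Finset C)) | ε ≤ setSup F x
        - (∑ y ∈ univ.powersetCard m, setSup F y) / #(univ.powersetCard m : Finset (Finset C))} : ℝ)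
        / #(univ.powersetCard m : Finset (Finset C)) := by
    intro ε
    rw [hE, ← hZ.measureReal_image]
    refine measureReal_congr ?_
    filter_upwards [hae] with ω hω
    exact propext (by
      change empiricalSup F Z ω - _ ≥ ε ↔ ε ≤ setSup F (univ.image fun i => Z i ω) - _
      rw [hω, ge_iff_le])
  have hL : ∀ ε : ℝ, P.real {ω | (∫ ω', empiricalSup F Z ω' ∂P) - empiricalSup F Z ω ≥ ε}
      = (#{x ∈ (univ.powersetCard m : Finset (Finset C)) | ε ≤
        (∑ y ∈ univ.powersetCard m, setSup F y) / #(univ.powersetCard m : Finset (Finset C))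
          - setSup F x} : ℝ) / #(univ.powersetCard m : Finset (Finset C)) := by
    intro ε
    rw [hE, ← hZ.measureReal_image]
    refine measureReal_congr ?_
    filter_upwards [hae] with ω hω
    exact propext (by
      change _ - empiricalSup F Z ω ≥ ε ↔ ε ≤ _ - setSup F (univ.image fun i => Z i ω)
      rw [hω, ge_iff_le])
  have hexp : ∀ ε : ℝ, ((Fintype.card C : ℝ) + 2) * ε ^ 2 / (8 * (Fintype.card C * (N * σ ^ 2)))
      = ((N : ℝ) + 2) * ε ^ 2 / (8 * (N : ℝ) ^ 2 * σ ^ 2) := by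
    intro ε
    rw [hNC]
    ring
  have tails : 0 < σ → ∀ ε : ℝ, 0 ≤ ε →
      P.real {ω | empiricalSup F Z ω - ∫ ω', empiricalSup F Z ω' ∂P ≥ ε}
        ≤ Real.exp (-(((N : ℝ) + 2) * ε ^ 2 / (8 * (N : ℝ) ^ 2 * σ ^ 2))) ∧
      P.real {ω | (∫ ω', empiricalSup F Z ω' ∂P) - empiricalSup F Z ω ≥ ε}
        ≤ Real.exp (-(((N : ℝ) + 2) * ε ^ 2 / (8 * (N : ℝ) ^ 2 * σ ^ 2))) := by
    intro hσp ε hε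
    have hV : 0 < (N : ℝ) * σ ^ 2 := by positivity
    -- On a one-point set a centred function vanishes, which would force `σ = 0`.
    have hN2 : 2 ≤ Fintype.card C := by
      by_contra hlt
      have h1 : Fintype.card C ≤ 1 := by omega
      have : Subsingleton C := Fintype.card_le_one_iff_subsingleton.1 h1
      have : Nonempty F := hFne.to_subtype
      have hz : ∀ f ∈ F, ∀ c, f c = 0 := fun f hf c => by
        have h := hF0 f hf
        rwa [Fintype.sum_subsingleton f c] at h
      have : supVariance F (Z ⟨0, hm⟩) P ≤ 0 := ciSup_le fun f => by
        rw [hvar f f.2]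
        simp [hz f f.2]
      rw [← hσ] at this
      linarith [pow_pos hσp 2]
    rw [hU, hL, ← hexp]
    exact ⟨setSup_upper_tail hFne hFbdd hF0 hV hFV hm hmC hε,
      setSup_lower_tail hFne (fun f hf c => (hFbdd f hf c).2) hV hFV hN2 hmC hε⟩
  have compare : 0 < σ → ∀ ε : ℝ, 0 < ε →
      Real.exp (-(((N : ℝ) + 2) * ε ^ 2 / (8 * (N : ℝ) ^ 2 * σ ^ 2)))
        < Real.exp (-(ε ^ 2 / (8 * (N : ℝ) * σ ^ 2))) := by
    intro hσp ε hε
    rw [Real.exp_lt_exp, neg_lt_neg_iff, div_lt_div_iff₀ (by positivity) (by positivity)]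
    have : 0 < ε ^ 2 * (16 * N * σ ^ 2) := by positivity
    linarith
  have degenerate : σ = 0 → empiricalSup F Z = fun _ => 0 := by
    rintro rfl
    have hz : ∀ f ∈ F, ∀ c, f c = 0 := fun f hf c => by
      have h := hFV f hf
      have h2 := single_le_sum (f := fun c => f c ^ 2) (fun c _ => sq_nonneg _) (mem_univ c)
      have h3 : f c ^ 2 = 0 := le_antisymm (by simp at h h2; linarith) (sq_nonneg _)
      exact pow_eq_zero_iff two_ne_zero |>.1 h3
    ext ω
    have : Nonempty F := hFne.to_subtype
    have h : ∀ f : F, ∑ i, (f : C → ℝ) (Z i ω) = 0 := fun f =>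
      sum_eq_zero fun i _ => hz f f.2 _
    simp only [empiricalSup, h, ciSup_const]
  refine ⟨tails, compare, fun h0 ε hε => ?_, fun t ht => ?_⟩
  · rw [degenerate h0]
    simp [hε.not_ge]
  · rcases hσ0.eq_or_lt with h0 | hσp
    · rw [degenerate h0.symm]
      simp [← h0, Real.exp_pos]
    · rcases ht.eq_or_lt with rfl | ht
      -- At `t = 0` the comparison is not strict; the claim is instead that a variable lies at or
      -- below its mean with positive probability.
      · have hint : Integrable (empiricalSup F Z) P := by
          have hmeas : Measurable fun ω i => Z i ω := measurable_pi_lambda _ hZ.measurable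
          have h1 : Integrable (fun ω => setSup F (univ.image fun i => Z i ω)) P := by
            have h2 : Measurable fun z : Fin m → C => setSup F (univ.image z) :=
              Measurable.of_discrete
            obtain ⟨K, hK⟩ := (Set.finite_range fun z : Fin m → C =>
              ‖setSup F (univ.image z)‖).bddAbove
            exact Integrable.of_bound (h2.comp hmeas).aestronglyMeasurable K
              (Filter.Eventually.of_forall fun ω => hK ⟨fun i => Z i ω, rfl⟩)
          exact h1.congr hae.symm
        have := measure_le_integral_pos hint
        simp only [mul_zero, Real.sqrt_zero, add_zero, neg_zero, Real.exp_zero, sub_self]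
        exact ENNReal.toReal_pos this.ne' (measure_ne_top _ _)
      -- Chosen so that the exponent of the simpler bound is exactly `t`; the strict comparison
      -- gives the strict inequality.
      · set ε := 2 * √(2 * (N : ℝ) * σ ^ 2 * t) with hεdef
        have hε : 0 < ε := by positivity
        have hεt : ε ^ 2 / (8 * (N : ℝ) * σ ^ 2) = t := by
          rw [hεdef, mul_pow, Real.sq_sqrt (by positivity)]
          field_simp
          norm_num
        have h1 := (tails hσp ε hε.le).1.trans_lt (compare hσp ε hε)
        rw [hεt] at h1
        have h2 : (Set.univ : Set Ω) ⊆ {ω | empiricalSup F Z ω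
            ≤ (∫ ω', empiricalSup F Z ω' ∂P) + ε}
            ∪ {ω | empiricalSup F Z ω - ∫ ω', empiricalSup F Z ω' ∂P ≥ ε} := by
          intro ω _
          rcases le_total (empiricalSup F Z ω) ((∫ ω', empiricalSup F Z ω' ∂P) + ε) with h | h
          · exact Or.inl h
          · exact Or.inr (le_sub_iff_add_le'.2 h)
        have h3 := (measureReal_mono h2 (μ := P)).trans (measureReal_union_le _ _)
        rw [probReal_univ] at h3
        linarith
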